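/- Let $k,m\in\mathbb N$, let $U\subset\mathbb R^m$ be nonempty and compact, and let $W=(W_t)_{t\in\mathbb N}$ be i.i.d. $\mathbb R^{k+m}$-valued random vectors on a probability space $(\Omega,\mathcal F,\mathbb P)$. Put $\mathcal F_t=\sigma(W_0,\dots,W_{t-1})$ (so $\mathcal F_0$ is trivial), and let $\mathcal A$ be the set of all $U$-valued $(\mathcal F_t)$-adapted processes $H=(H_t)_{t\in\mathbb N}$. Let $G:\mathbb R^k\times\mathbb R^{k+m}\to\mathbb R^k$ be Borel measurable with $x\mapsto G(x,w)$ continuous for every $w$, and let $F:\mathbb R^k\times U\times\mathbb R^{k+m}\to\mathbb R$ be Borel measurable with $(x,h)\mapsto F(x,h,w)$ continuous for every $w$. For $X_0\in\mathbb R^k$, $V_0>0$ and $H\in\mathcal A$ define $$X_{t+1}=G(X_t,W_t),\qquad V^H_0=V_0,\qquad \ln\frac{V^H_{t+1}}{V^H_t}=F(X_t,H_t,W_t).$$ For a real random variable $Z$ let $\mu^\gamma(Z)=\frac1\gamma\ln\mathbb E[e^{\gamma Z}]$ if $\gamma\ne0$ and $\mu^0(Z)=\mathbb E[Z]$, and for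 $\gamma<0$ let $$\varphi^\gamma(V)=\liminf_{t\to\infty}\frac1t\,\frac1\gamma\ln\mathbb E[V_t^\gamma].$$ Assume that there are a continuous $\omega:\mathbb R^k\to[0,\infty)$, Borel functions $a_1,a_2:\mathbb R^{k+m}\to[0,\infty)$ and constants $b_1\in(0,1)$, $b_2>0$ such that, for all $x,h,w$, $$\omega(G(x,w))\le a_1(w)+b_1\omega(x),\qquad |F(x,h,w)|\le a_2(w)+b_2\omega(x),$$ and $\mu^\gamma(a_1(W_0)),\mu^\gamma(a_2(W_0))\in\mathbb R$ for every $\gamma\in\mathbb R$. Assume also that for every $R>0$ there are $c>0$ and a probability measure $\nu$ on $\mathbb R^k$ such that $\mathbb P[G(x,W_0)\in A]\ge c\,\nu(A)$ for all Borel $A\subset\mathbb R^k$ and all $x$ with $\omega(x)\le R$. Let $\mathcal C_\omega(\mathbb R^k)$ be the set of continuous $f:\mathbb R^k\to\mathbb R$ with $\sup_x |f(x)|/(1+\omega(x))<\infty$. Then there is $\gamma_0<0$, not depending on $X_0$ and $V_0$, such that for every $\gamma\in(\gamma_0,0)$ the Bellman equation $$v(x)+\lambda=\sup_{h\in U}\mu^\gamma\big(F(x,h,W_0)+v(G(x,W_0))\big),\qquad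 x\in\mathbb R^k,$$ has a solution $(v_\gamma,\lambda_\gamma)\in\mathcal C_\omega(\mathbb R^k)\times\mathbb R$, with $\lambda_\gamma$ unique and $v_\gamma$ unique up to an additive constant, and, for all $X_0\in\mathbb R^k$ and $V_0>0$, $$\lambda_\gamma\ \ge\ \sup_{H\in\mathcal A}\varphi^\gamma(V^H).$$ If, moreover, $a_1$ is bounded from above, then, for all $X_0\in\mathbb R^k$ and $V_0>0$, $\lambda_\gamma=\sup_{H\in\mathcal A}\varphi^\gamma(V^H)$, and optimal strategies are given by selectors of the Bellman equation: there is a Borel map $\eta:\mathbb R^k\to U$ such that, for every $x\in\mathbb R^k$, $h=\eta(x)$ attains the supremum in the Bellman equation with $v=v_\gamma$; and for every such $\eta$ the strategy $\hat H_t=\eta(X_t)$ belongs to $\mathcal A$ and satisfies $\varphi^\gamma(V^{\hat H})=\lambda_\gamma$ for all $X_0\in\mathbb R^k$ and $V_0>0$. -/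

import Mathlib

open MeasureTheory ProbabilityTheory Filter

namespace RSC

/-- `n`-dimensional real space. -/
abbrev Vec (n : ℕ) : Type := EuclideanSpace ℝ (Fin n)

noncomputable section

variable {Ω : Type*}

/-- The entropic utility `μ^γ(Z)`, an extended real number: `(1/γ) ln E[exp (γ Z)]` if `γ ≠ 0`, and
`E[Z] = E[Z⁺] - E[Z⁻]` if `γ = 0`. The expectations are taken in `[0, ∞]`. -/
def entropicUtility [MeasurableSpace Ω] (P : Measure Ω) (γ : ℝ) (Z : Ω → ℝ) : EReal :=
  if γ = 0 then
    ((∫⁻ o, ENNReal.ofReal (Z o) ∂P : ENNReal) : EReal) -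
      ((∫⁻ o, ENNReal.ofReal (-Z o) ∂P : ENNReal) : EReal)
  else
    ((1 / γ : ℝ) : EReal) * ENNReal.log (∫⁻ o, ENNReal.ofReal (Real.exp (γ * Z o)) ∂P)

/-- The risk sensitive criterion `φ^γ(V) = liminf_{t → ∞} (1/t) (1/γ) ln E[V_t ^ γ]` of a positive
process `V`, as an extended real number. -/
def riskSensitiveCriterion [MeasurableSpace Ω] (P : Measure Ω) (γ : ℝ) (V : ℕ → Ω → ℝ) : EReal :=
  liminf (fun t : ℕ => ((1 / (t : ℝ) : ℝ) : EReal) *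
    (((1 / γ : ℝ) : EReal) * ENNReal.log (∫⁻ o, ENNReal.ofReal (V t o ^ γ) ∂P))) atTop

/-- The `σ`-algebra `𝓕_t` generated by `W_0, …, W_{t-1}`; in particular `𝓕_0` is trivial. -/
abbrev noiseSigma {n : ℕ} (W : ℕ → Ω → Vec n) (t : ℕ) : MeasurableSpace Ω :=
  ⨆ s : ℕ, ⨆ _ : s < t, MeasurableSpace.comap (W s) inferInstance

/-- (A.1) The noise `W_0, W_1, …` is a sequence of i.i.d. random vectors. -/
structure IsIIDNoise {n : ℕ} [MeasurableSpace Ω] (P : Measure Ω) (W : ℕ → Ω → Vec n) : Prop where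
  measurable : ∀ t, Measurable (W t)
  indep : iIndepFun W P
  identDistrib : ∀ t, IdentDistrib (W t) (W 0) P P

/-- The factor process: `X_0 = x₀`, `X_{t+1} = G (X_t, W_t)`. -/
def factor {k n : ℕ} (G : Vec k → Vec n → Vec k) (W : ℕ → Ω → Vec n) (x₀ : Vec k) :
    ℕ → Ω → Vec k
  | 0 => fun _ => x₀
  | t + 1 => fun o => G (factor G W x₀ t o) (W t o)

/-- (A.2) `G` is Borel measurable, and continuous in its first variable. -/
structure IsFactorMap {k n : ℕ} (G : Vec k → Vec n → Vec k) : Prop where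
  measurable : Measurable fun p : Vec k × Vec n => G p.1 p.2
  continuous : ∀ w, Continuous fun x => G x w

/-- (A.3) `F` is Borel measurable, and continuous in its first two variables (jointly). -/
structure IsLogReturnMap {k m n : ℕ} {U : Set (Vec m)} (F : Vec k → U → Vec n → ℝ) : Prop where
  measurable : Measurable fun p : Vec k × U × Vec n => F p.1 p.2.1 p.2.2
  continuous : ∀ w, Continuous fun p : Vec k × U => F p.1 p.2 w

/-- A strategy is a `U`-valued process `H`; it is admissible if it is adapted to the filtration
generated by the noise. -/
def IsAdmissible {m n : ℕ} {U : Set (Vec m)} (W : ℕ → Ω → Vec n) (H : ℕ → Ω → U) : Prop :=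
  ∀ t, Measurable[noiseSigma W t] (H t)

/-- The portfolio value process of the strategy `H`: `V_0 = V₀` and
`ln (V_{t+1} / V_t) = F (X_t, H_t, W_t)`, where `X` is the factor process started at `x₀`. -/
def portfolioValue {k m n : ℕ} {U : Set (Vec m)} (G : Vec k → Vec n → Vec k)
    (F : Vec k → U → Vec n → ℝ) (W : ℕ → Ω → Vec n) (x₀ : Vec k) (V₀ : ℝ) (H : ℕ → Ω → U) :
    ℕ → Ω → ℝ
  | 0 => fun _ => V₀
  | t + 1 => fun o =>
      portfolioValue G F W x₀ V₀ H t o * Real.exp (F (factor G W x₀ t o) (H t o) (W t o))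

/-- The optimal value `sup_H φ^γ(V^H)` over all admissible strategies `H`. -/
def optimalValue {k m n : ℕ} {U : Set (Vec m)} [MeasurableSpace Ω] (P : Measure Ω) (G : Vec k → Vec n → Vec k)
    (F : Vec k → U → Vec n → ℝ) (W : ℕ → Ω → Vec n) (γ : ℝ) (x₀ : Vec k) (V₀ : ℝ) : EReal :=
  ⨆ H : {H : ℕ → Ω → U // IsAdmissible W H},
    riskSensitiveCriterion P γ (portfolioValue G F W x₀ V₀ H.1)

/-- (A.4) The growth conditions with respect to the weight function `ω`, and finiteness of the
entropic utilities of `a₁ (W_0)` and `a₂ (W_0)`. -/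
structure HasWeightedGrowth {k m n : ℕ} {U : Set (Vec m)} [MeasurableSpace Ω] (P : Measure Ω) (W : ℕ → Ω → Vec n)
    (G : Vec k → Vec n → Vec k) (F : Vec k → U → Vec n → ℝ) (ω : Vec k → ℝ)
    (a₁ a₂ : Vec n → ℝ) (b₁ b₂ : ℝ) : Prop where
  weight_continuous : Continuous ω
  weight_nonneg : ∀ x, 0 ≤ ω x
  a₁_measurable : Measurable a₁
  a₂_measurable : Measurable a₂
  a₁_nonneg : ∀ w, 0 ≤ a₁ w
  a₂_nonneg : ∀ w, 0 ≤ a₂ w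
  b₁_pos : 0 < b₁
  b₁_lt_one : b₁ < 1
  b₂_pos : 0 < b₂
  growth_G : ∀ x w, ω (G x w) ≤ a₁ w + b₁ * ω x
  growth_F : ∀ x h w, |F x h w| ≤ a₂ w + b₂ * ω x
  a₁_utility : ∀ γ : ℝ, ∃ r : ℝ, entropicUtility P γ (fun o => a₁ (W 0 o)) = (r : EReal)
  a₂_utility : ∀ γ : ℝ, ∃ r : ℝ, entropicUtility P γ (fun o => a₂ (W 0 o)) = (r : EReal)

/-- (A.5) Local minorization on the sublevel sets `C_R = {x | ω x ≤ R}`. -/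
def HasLocalMinorization {k n : ℕ} [MeasurableSpace Ω] (P : Measure Ω) (W : ℕ → Ω → Vec n)
    (G : Vec k → Vec n → Vec k) (ω : Vec k → ℝ) : Prop :=
  ∀ R : ℝ, 0 < R → ∃ c : ℝ, 0 < c ∧ ∃ ν : Measure (Vec k), IsProbabilityMeasure ν ∧
    ∀ x, ω x ≤ R → ∀ A : Set (Vec k), MeasurableSet A →
      ENNReal.ofReal c * ν A ≤ P {o | G x (W 0 o) ∈ A}

/-- The space `C_ω(ℝ^k)` of continuous functions with finite `ω`-norm
`sup_x |f x| / (1 + ω x)`. -/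
def MemWeighted {k : ℕ} (ω : Vec k → ℝ) (f : Vec k → ℝ) : Prop :=
  Continuous f ∧ BddAbove (Set.range fun x => |f x| / (1 + ω x))

/-- The quantity `μ^γ(F(x, h, W_0) + v(G(x, W_0)))` which is maximized over `h ∈ U` in the Bellman
equation. -/
def bellmanUtility {k m n : ℕ} {U : Set (Vec m)} [MeasurableSpace Ω] (P : Measure Ω) (G : Vec k → Vec n → Vec k)
    (F : Vec k → U → Vec n → ℝ) (W : ℕ → Ω → Vec n) (γ : ℝ) (v : Vec k → ℝ) (x : Vec k) (h : U) :
    EReal :=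
  entropicUtility P γ (fun o => F x h (W 0 o) + v (G x (W 0 o)))

/-- `v ∈ C_ω(ℝ^k)` and `lam ∈ ℝ` solve the Bellman equation
`v(x) + lam = sup_{h ∈ U} μ^γ(F(x, h, W_0) + v(G(x, W_0)))` for all `x`. -/
def IsBellmanSolution {k m n : ℕ} {U : Set (Vec m)} [MeasurableSpace Ω] (P : Measure Ω) (G : Vec k → Vec n → Vec k)
    (F : Vec k → U → Vec n → ℝ) (W : ℕ → Ω → Vec n) (ω : Vec k → ℝ) (γ : ℝ)
    (v : Vec k → ℝ) (lam : ℝ) : Prop :=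
  MemWeighted ω v ∧ ∀ x, ((v x + lam : ℝ) : EReal) = ⨆ h : U, bellmanUtility P G F W γ v x h

/-- A Borel selector of the Bellman equation: a Borel map `x ↦ η x ∈ U` that attains the supremum
on its right-hand side for every `x`. -/
def IsBellmanSelector {k m n : ℕ} {U : Set (Vec m)} [MeasurableSpace Ω] (P : Measure Ω) (G : Vec k → Vec n → Vec k)
    (F : Vec k → U → Vec n → ℝ) (W : ℕ → Ω → Vec n) (γ : ℝ)
    (v : Vec k → ℝ) (η : Vec k → U) : Prop :=
  Measurable η ∧ ∀ x, bellmanUtility P G F W γ v x (η x) = ⨆ h : U, bellmanUtility P G F W γ v x h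

end

end RSC

/-!
For `γ < 0` the Gibbs variational formula bounds the difference of two entropic utilities by the
difference of their integrands averaged over an exponentially tilted kernel. When `|γ|` is small
compared with the growth of the functions involved, the tilted kernels inherit the drift and the
local minorization of the factor chain with uniform constants, so Harris' theorem in the form of
Hairer and Mattingly makes the Bellman operator a contraction of a weighted oscillation seminorm.
Relative value iteration then produces the solution, and contraction along two solutions gives
uniqueness.

For the verification, conditioning on the past turns the Bellman inequality into
`E[V_t ^ γ * exp (γ * v (X_t))] ≥ exp (γ * lam * t + const)`. Hölder's inequality separates the
weight `exp (γ * v (X_t))`, and it costs nothing in the limit because the exponential growth rate of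
`E[V_t ^ γ * exp (θ * ω (X_t))]` is bounded independently of `θ`. For bounded `a₁` the factor stays
in a sublevel set of `ω`, the weight is bounded, and selectors attain `lam`.
-/

namespace RSC

/-! ### Tilted measures and exponential envelopes -/

section LogLaplace

variable {S : Type*} [MeasurableSpace S]

/-- The log-Laplace functional `Z ↦ ln ∫ exp Z dρ`, of which the entropic utility is the rescaling
`Z ↦ γ⁻¹ ln ∫ exp (γ Z) dρ`. -/
noncomputable def logLaplace (ρ : Measure S) (Z : S → ℝ) : ℝ :=
  Real.log (∫ w, Real.exp (Z w) ∂ρ)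

variable {ρ : Measure S} {Z Z₁ Z₂ : S → ℝ}

lemma integral_tilted_eq_div (ρ : Measure S) (Z φ : S → ℝ) :
    ∫ w, φ w ∂(ρ.tilted Z) = (∫ w, Real.exp (Z w) * φ w ∂ρ) / ∫ w, Real.exp (Z w) ∂ρ := by
  rw [integral_tilted, ← integral_div]
  simp only [smul_eq_mul, div_mul_eq_mul_div]

/-- Jensen's inequality for `exp` under `ρ.tilted Z₂`. -/
theorem integral_tilted_sub_le [NeZero ρ] (h₁ : Integrable (fun w => Real.exp (Z₁ w)) ρ)
    (h₂ : Integrable (fun w => Real.exp (Z₂ w)) ρ)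
    (hsub : Integrable (fun w => Z₁ w - Z₂ w) (ρ.tilted Z₂)) :
    ∫ w, (Z₁ w - Z₂ w) ∂(ρ.tilted Z₂) ≤ logLaplace ρ Z₁ - logLaplace ρ Z₂ := by
  have := isProbabilityMeasure_tilted h₂
  have hmul (w : S) : Real.exp (Z₂ w) * Real.exp (Z₁ w - Z₂ w) = Real.exp (Z₁ w) := by
    rw [← Real.exp_add, add_sub_cancel]
  have hint : Integrable (fun w => Real.exp (Z₁ w - Z₂ w)) (ρ.tilted Z₂) := by
    simpa only [integrable_tilted_iff h₂, smul_eq_mul, hmul] using h₁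
  rw [logLaplace, logLaplace, ← Real.log_div (integral_exp_pos h₁).ne' (integral_exp_pos h₂).ne',
    Real.le_log_iff_exp_le (div_pos (integral_exp_pos h₁) (integral_exp_pos h₂))]
  calc Real.exp (∫ w, (Z₁ w - Z₂ w) ∂(ρ.tilted Z₂))
      ≤ ∫ w, Real.exp (Z₁ w - Z₂ w) ∂(ρ.tilted Z₂) :=
        convexOn_exp.map_integral_le Real.continuous_exp.continuousOn isClosed_univ
          (ae_of_all _ fun _ => Set.mem_univ _) hsub hint
    _ = _ := by simp only [integral_tilted_eq_div, hmul]

lemma integral_le_logLaplace [IsProbabilityMeasure ρ]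
    (h : Integrable (fun w => Real.exp (Z w)) ρ) (hZ : Integrable Z ρ) :
    ∫ w, Z w ∂ρ ≤ logLaplace ρ Z := by
  simpa [logLaplace, tilted_const] using
    integral_tilted_sub_le (Z₂ := fun _ => 0) h (by simp) (by simpa [tilted_const] using hZ)

lemma logLaplace_mono [NeZero ρ] (h₁ : Integrable (fun w => Real.exp (Z₁ w)) ρ)
    (h₂ : Integrable (fun w => Real.exp (Z₂ w)) ρ) (hle : ∀ w, Z₁ w ≤ Z₂ w) :
    logLaplace ρ Z₁ ≤ logLaplace ρ Z₂ :=
  Real.log_le_log (integral_exp_pos h₁) <| integral_mono h₁ h₂ fun w =>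
    Real.exp_le_exp.mpr (hle w)

lemma logLaplace_add_const [NeZero ρ] (h : Integrable (fun w => Real.exp (Z w)) ρ) (c : ℝ) :
    logLaplace ρ (fun w => Z w + c) = logLaplace ρ Z + c := by
  simp only [logLaplace, Real.exp_add]
  rw [integral_mul_const, Real.log_mul (integral_exp_pos h).ne' (Real.exp_pos c).ne', Real.log_exp]

lemma logLaplace_const_mul_le [IsProbabilityMeasure ρ] {p : ℝ} (hp₀ : 0 ≤ p) (hp₁ : p ≤ 1)
    (hp : Integrable (fun w => Real.exp (p * Z w)) ρ)
    (h : Integrable (fun w => Real.exp (Z w)) ρ) :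
    logLaplace ρ (fun w => p * Z w) ≤ p * logLaplace ρ Z := by
  have hpow (w : S) : Real.exp (p * Z w) = Real.exp (Z w) ^ p := by
    rw [← Real.exp_mul, mul_comm]
  simp only [hpow] at hp
  have hJensen : ∫ w, Real.exp (Z w) ^ p ∂ρ ≤ (∫ w, Real.exp (Z w) ∂ρ) ^ p :=
    (Real.concaveOn_rpow hp₀ hp₁).le_map_integral
      (Real.continuous_rpow_const hp₀).continuousOn isClosed_Ici
      (ae_of_all _ fun w => (Real.exp_pos (Z w)).le) h hp
  have hpos : 0 < ∫ w, Real.exp (Z w) ^ p ∂ρ := by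
    simp only [← hpow] at hp ⊢
    exact integral_exp_pos hp
  simp only [logLaplace, hpow]
  rw [← Real.log_rpow (integral_exp_pos h)]
  exact Real.log_le_log hpos hJensen

end LogLaplace

section ExpEnvelope

variable {S : Type*} [MeasurableSpace S]

/-- A measurable envelope `s ≥ 1` with finite exponential moments of all orders. Functions bounded
by a multiple of `s` may be exponentiated and integrated freely. -/
structure IsExpEnvelope (ρ : Measure S) (s : S → ℝ) : Prop where
  measurable : Measurable s
  one_le : ∀ w, 1 ≤ s w
  integrable_exp : ∀ θ : ℝ, Integrable (fun w => Real.exp (θ * s w)) ρ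

/-- `Z` is measurable and dominated by a multiple of the envelope `s`. -/
def Dominated (s Z : S → ℝ) : Prop :=
  Measurable Z ∧ ∃ C : ℝ, ∀ w, |Z w| ≤ C * s w

variable {ρ : Measure S} {s Z Z₁ Z₂ φ : S → ℝ}

lemma Dominated.measurable (h : Dominated s Z) : Measurable Z := h.1

lemma Dominated.add (h₁ : Dominated s Z₁) (h₂ : Dominated s Z₂) :
    Dominated s (fun w => Z₁ w + Z₂ w) := by
  obtain ⟨m₁, C₁, h₁⟩ := h₁
  obtain ⟨m₂, C₂, h₂⟩ := h₂
  refine ⟨m₁.add m₂, C₁ + C₂, fun w => (abs_add_le _ _).trans ?_⟩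
  linarith [h₁ w, h₂ w]

lemma Dominated.const_mul (h : Dominated s Z) (c : ℝ) : Dominated s (fun w => c * Z w) := by
  obtain ⟨m, C, h⟩ := h
  refine ⟨m.const_mul c, |c| * C, fun w => ?_⟩
  rw [abs_mul, mul_assoc]
  exact mul_le_mul_of_nonneg_left (h w) (abs_nonneg c)

lemma Dominated.sub (h₁ : Dominated s Z₁) (h₂ : Dominated s Z₂) :
    Dominated s (fun w => Z₁ w - Z₂ w) := by
  simpa [sub_eq_add_neg] using h₁.add (h₂.const_mul (-1))

namespace IsExpEnvelope

lemma pos (hs : IsExpEnvelope ρ s) (w : S) : 0 < s w :=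
  zero_lt_one.trans_le (hs.one_le w)

lemma dominated_const (hs : IsExpEnvelope ρ s) (c : ℝ) : Dominated s (fun _ => c) :=
  ⟨measurable_const, |c|, fun w => le_mul_of_one_le_right (abs_nonneg c) (hs.one_le w)⟩

lemma dominated (hs : IsExpEnvelope ρ s) : Dominated s s :=
  ⟨hs.measurable, 1, fun w => by rw [one_mul, abs_of_pos (hs.pos w)]⟩

lemma dominated_of_abs_le (hs : IsExpEnvelope ρ s) (hZ : Measurable Z) {C c : ℝ}
    (h : ∀ w, |Z w| ≤ C * s w + c) : Dominated s Z := by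
  refine ⟨hZ, C + |c|, fun w => (h w).trans ?_⟩
  linarith [le_mul_of_one_le_right (abs_nonneg c) (hs.one_le w), le_abs_self c]

lemma integrable_exp_mul (hs : IsExpEnvelope ρ s) (hZ : Dominated s Z) (hφ : Dominated s φ) :
    Integrable (fun w => Real.exp (Z w) * φ w) ρ := by
  obtain ⟨mZ, C, hZ⟩ := hZ
  obtain ⟨mφ, C', hφ⟩ := hφ
  refine ((hs.integrable_exp (C + 1)).const_mul |C'|).mono'
    (mZ.exp.mul mφ).aestronglyMeasurable (ae_of_all _ fun w => ?_)
  have hφ_exp : |φ w| ≤ |C'| * Real.exp (s w) :=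
    (hφ w).trans (mul_le_mul (le_abs_self C') (by linarith [Real.add_one_le_exp (s w)])
      (hs.pos w).le (abs_nonneg _))
  have hZ_exp : Real.exp (Z w) ≤ Real.exp (C * s w) :=
    Real.exp_le_exp.mpr ((le_abs_self _).trans (hZ w))
  rw [Real.norm_eq_abs, abs_mul, abs_of_pos (Real.exp_pos _), add_mul, one_mul, Real.exp_add]
  calc _ ≤ Real.exp (C * s w) * (|C'| * Real.exp (s w)) :=
        mul_le_mul hZ_exp hφ_exp (abs_nonneg _) (Real.exp_pos _).le
    _ = _ := by ring

lemma integrable_exp_of (hs : IsExpEnvelope ρ s) (hZ : Dominated s Z) :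
    Integrable (fun w => Real.exp (Z w)) ρ := by
  simpa using hs.integrable_exp_mul hZ (hs.dominated_const 1)

lemma integrable_of (hs : IsExpEnvelope ρ s) (hZ : Dominated s Z) : Integrable Z ρ := by
  simpa using hs.integrable_exp_mul (hs.dominated_const 0) hZ

lemma integrable_tilted (hs : IsExpEnvelope ρ s) (hZ : Dominated s Z) (hφ : Dominated s φ) :
    Integrable φ (ρ.tilted Z) := by
  rw [integrable_tilted_iff (hs.integrable_exp_of hZ)]
  exact hs.integrable_exp_mul hZ hφ

end IsExpEnvelope

end ExpEnvelope

/-! ### Harris' theorem for set-valued kernels -/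

section Harris

variable {X : Type*} [MeasurableSpace X]

/-- Two laws overlap by `α` if their total variation distance is at most `2 (1 - α)`; this is
expressed by the integrals of bounded functions. -/
def Overlaps (α : ℝ) (p q : Measure X) : Prop :=
  ∀ ψ : X → ℝ, Measurable ψ → ∀ M, (∀ z, |ψ z| ≤ M) →
    ∫ z, ψ z ∂p - ∫ z, ψ z ∂q ≤ 2 * (1 - α) * M

variable {α ε : ℝ} {p q ν : Measure X} [IsProbabilityMeasure p] [IsProbabilityMeasure q]

lemma integrable_of_abs_le {ψ : X → ℝ} (hψ : Measurable ψ) {M : ℝ} (h : ∀ z, |ψ z| ≤ M) :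
    Integrable ψ p :=
  Integrable.of_bound hψ.aestronglyMeasurable M (ae_of_all _ h)

lemma overlaps_zero (p q : Measure X) [IsProbabilityMeasure p] [IsProbabilityMeasure q] :
    Overlaps 0 p q := fun ψ _ M hM => by
  have hp := norm_integral_le_of_norm_le_const (μ := p) (f := ψ) (ae_of_all _ hM)
  have hq := norm_integral_le_of_norm_le_const (μ := q) (f := ψ) (ae_of_all _ hM)
  simp only [Real.norm_eq_abs, probReal_univ, mul_one] at hp hq
  linarith [(abs_le.mp hp).2, (abs_le.mp hq).1]

lemma overlaps_of_minorized [IsProbabilityMeasure ν]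
    (hp : ∀ φ : X → ℝ, Measurable φ → (∀ z, φ z ∈ Set.Icc 0 1) →
      ε * (∫ z, φ z ∂ν - 1 / 4) ≤ ∫ z, φ z ∂p)
    (hq : ∀ φ : X → ℝ, Measurable φ → (∀ z, φ z ∈ Set.Icc 0 1) →
      ε * (∫ z, φ z ∂ν - 1 / 4) ≤ ∫ z, φ z ∂q) :
    Overlaps (ε / 2) p q := by
  intro ψ hψ M hψM
  obtain ⟨z₀⟩ := nonempty_of_isProbabilityMeasure ν
  rcases ((abs_nonneg _).trans (hψM z₀)).eq_or_lt with rfl | hM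
  · simp [fun z => abs_nonpos_iff.mp (hψM z)]
  -- The test functions `(M ∓ ψ) / (2 M)` take values in `[0, 1]` and add up to `1`.
  have htest (σ : ℝ) (hσ : |σ| = 1) (z : X) : (M + σ * ψ z) / (2 * M) ∈ Set.Icc (0 : ℝ) 1 := by
    have hz : |σ * ψ z| ≤ M := by rw [abs_mul, hσ, one_mul]; exact hψM z
    have := abs_le.mp hz
    exact ⟨div_nonneg (by linarith) (by linarith), (div_le_one (by linarith)).mpr (by linarith)⟩
  have hmeas (σ : ℝ) : Measurable fun z => (M + σ * ψ z) / (2 * M) :=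
    ((hψ.const_mul σ).const_add M).div_const _
  have hintegral (σ : ℝ) (μ : Measure X) [IsProbabilityMeasure μ] :
      ∫ z, (M + σ * ψ z) / (2 * M) ∂μ = (M + σ * ∫ z, ψ z ∂μ) / (2 * M) := by
    rw [integral_div, integral_add (integrable_const _)
      ((integrable_of_abs_le hψ hψM).const_mul _), integral_const_mul]
    simp
  have hp' := hp _ (hmeas (-1)) (htest (-1) (by simp))
  have hq' := hq _ (hmeas 1) (htest 1 (by simp))
  rw [hintegral, hintegral] at hp' hq'
  have hsum := add_le_add hp' hq'
  have hl : ε * ((M + -1 * ∫ z, ψ z ∂ν) / (2 * M) - 1 / 4) +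
      ε * ((M + 1 * ∫ z, ψ z ∂ν) / (2 * M) - 1 / 4) = ε / 2 := by field_simp; ring
  rw [hl, ← add_div, le_div_iff₀ (by positivity)] at hsum
  linarith

lemma abs_sub_truncation_le {t M g : ℝ} (hM : 0 ≤ M) (hg : 0 ≤ g) (h : |t| ≤ M + g) :
    |t - max (-M) (min M t)| ≤ g := by
  grind

lemma Overlaps.integral_sub_le (h : Overlaps α p q) {φ g : X → ℝ} (hφ : Measurable φ) {M : ℝ}
    (hM : 0 ≤ M) (hg₀ : ∀ z, 0 ≤ g z) (hgp : Integrable g p) (hgq : Integrable g q)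
    (hφg : ∀ z, |φ z| ≤ M + g z) :
    ∫ z, φ z ∂p - ∫ z, φ z ∂q ≤ 2 * (1 - α) * M + ∫ z, g z ∂p + ∫ z, g z ∂q := by
  set ψ : X → ℝ := fun z => max (-M) (min M (φ z))
  have hψ : Measurable ψ := measurable_const.max (measurable_const.min hφ)
  have hψM (z : X) : |ψ z| ≤ M :=
    abs_le.mpr ⟨le_max_left _ _, max_le (by linarith) (min_le_left _ _)⟩
  have htrunc (z : X) : |φ z - ψ z| ≤ g z := abs_sub_truncation_le hM (hg₀ z) (hφg z)
  have hdist (μ : Measure X) [IsProbabilityMeasure μ] (hg : Integrable g μ) :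
      |∫ z, φ z ∂μ - ∫ z, ψ z ∂μ| ≤ ∫ z, g z ∂μ := by
    have hφμ : Integrable φ μ :=
      ((integrable_const M).add hg).mono' hφ.aestronglyMeasurable (ae_of_all _ hφg)
    rw [← integral_sub hφμ (integrable_of_abs_le hψ hψM)]
    exact norm_integral_le_of_norm_le (f := fun z => φ z - ψ z) hg (ae_of_all _ htrunc)
  linarith [h ψ hψ M hψM, (abs_le.mp (hdist p hgp)).2, (abs_le.mp (hdist q hgq)).1]

/-- The weight `β` is taken so small that the drift constant `2 K` costs at most the overlap `α`
on `r ≤ R`, and the gain on `r ≥ R` comes from the drift alone. -/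
lemma exists_harris_constants {α b K R : ℝ} (hα : 0 < α) (hb : b < 1) (hK : 0 ≤ K)
    (hR : 0 < R) (hKR : 4 * K ≤ (1 - b) * R) :
    ∃ β L : ℝ, 0 < β ∧ β ≤ 1 ∧ 0 ≤ L ∧ L < 1 ∧
      (∀ r, 0 ≤ r → r ≤ R → 2 * (1 - α) + β * (b * r + 2 * K) ≤ L * (2 + β * r)) ∧
      ∀ r, R ≤ r → 2 + β * (b * r + 2 * K) ≤ L * (2 + β * r) := by
  obtain ⟨β, hβ₀, hβ₁, hβK⟩ : ∃ β, 0 < β ∧ β ≤ 1 ∧ β * (2 * K) ≤ α := by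
    refine ⟨min 1 (α / (2 * K + 1)), by positivity, min_le_left _ _, ?_⟩
    calc min 1 (α / (2 * K + 1)) * (2 * K) ≤ α / (2 * K + 1) * (2 * K + 1) := by
          gcongr
          · exact min_le_right _ _
          · linarith
      _ = α := by field_simp
  have hβR : 0 < β * R := mul_pos hβ₀ hR
  set b' := (1 + b) / 2 with hb'
  -- `Lfar = 1 - β (1 - b') R / (2 + β R)` is the contraction rate at `r = R` without overlap.
  set Lfar := (2 + b' * (β * R)) / (2 + β * R) with hLfar
  have hLfar₁ : Lfar < 1 := by rw [hLfar, div_lt_one (by positivity)]; nlinarith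
  have hLfar_eq : Lfar * (2 + β * R) = 2 + b' * (β * R) := by rw [hLfar]; field_simp
  have hLfar_b' : b' ≤ Lfar := by rw [hLfar, le_div_iff₀ (by positivity)]; nlinarith
  set L := max (max (1 - α / 2) (max b 0)) Lfar
  have hLα : 1 - α / 2 ≤ L := (le_max_left _ _).trans (le_max_left _ _)
  have hLb : b ≤ L := (le_max_left _ _).trans ((le_max_right _ _).trans (le_max_left _ _))
  have hL₀ : 0 ≤ L := (le_max_right _ _).trans ((le_max_right _ _).trans (le_max_left _ _))
  have hL₁ : L < 1 := by simp only [L, max_lt_iff]; exact ⟨⟨by linarith, hb, one_pos⟩, hLfar₁⟩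
  refine ⟨β, L, hβ₀, hβ₁, hL₀, hL₁, fun r hr _ => ?_, fun r hr => ?_⟩
  · linarith [mul_le_mul_of_nonneg_right hLb (mul_nonneg hβ₀.le hr)]
  · have hβr : β * R ≤ β * r := mul_le_mul_of_nonneg_left hr hβ₀.le
    have hfar : 2 + b' * (β * r) ≤ Lfar * (2 + β * r) := by
      linarith [mul_le_mul_of_nonneg_right hLfar_b' (sub_nonneg.mpr hβr)]
    have hKr : 4 * K ≤ (1 - b) * r :=
      hKR.trans (mul_le_mul_of_nonneg_left hr (by linarith))
    calc 2 + β * (b * r + 2 * K) ≤ 2 + b' * (β * r) := by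
          rw [hb']; linarith [mul_le_mul_of_nonneg_left hKr hβ₀.le]
      _ ≤ Lfar * (2 + β * r) := hfar
      _ ≤ L * (2 + β * r) :=
          mul_le_mul_of_nonneg_right (le_max_right _ _) (by linarith)

/-- Harris' theorem in the form of Hairer and Mattingly, for a set `T x` of laws at every state. -/
theorem exists_weighted_contraction {T : X → Set (Measure X)} {ω : X → ℝ} {b K : ℝ}
    (hprob : ∀ x, ∀ p ∈ T x, IsProbabilityMeasure p) (hω₀ : ∀ x, 0 ≤ ω x)
    (hωint : ∀ x, ∀ p ∈ T x, Integrable ω p) (hb : b < 1) (hK : 0 ≤ K)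
    (hdrift : ∀ x, ∀ p ∈ T x, ∫ z, ω z ∂p ≤ b * ω x + K)
    (hoverlap : ∀ R, 0 < R → ∃ α, 0 < α ∧ ∀ x y, ω x ≤ R → ω y ≤ R →
      ∀ p ∈ T x, ∀ q ∈ T y, Overlaps α p q) :
    ∃ β L : ℝ, 0 < β ∧ β ≤ 1 ∧ 0 ≤ L ∧ L < 1 ∧
      ∀ x y, ∀ p ∈ T x, ∀ q ∈ T y, ∀ φ : X → ℝ, Measurable φ →
        ∀ M, (∀ z, |φ z| ≤ M * (1 + β * ω z)) →
          ∫ z, φ z ∂p - ∫ z, φ z ∂q ≤ L * (M * (2 + β * ω x + β * ω y)) := by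
  have hb' : 0 < 1 - b := sub_pos.mpr hb
  obtain ⟨R, hR, hKR⟩ : ∃ R, 0 < R ∧ 4 * K ≤ (1 - b) * R :=
    ⟨4 * K / (1 - b) + 1, by positivity, by rw [mul_add, mul_div_cancel₀ _ hb'.ne']; linarith⟩
  obtain ⟨α, hα, hT⟩ := hoverlap R hR
  obtain ⟨β, L, hβ₀, hβ₁, hL₀, hL₁, hnear, hfar⟩ := exists_harris_constants hα hb hK hR hKR
  refine ⟨β, L, hβ₀, hβ₁, hL₀, hL₁, fun x y p hp q hq φ hφ M hφM => ?_⟩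
  have := hprob x p hp
  have := hprob y q hq
  have hweight (z : X) : 0 < 1 + β * ω z := by nlinarith [hω₀ z]
  have hM : 0 ≤ M := nonneg_of_mul_nonneg_left ((abs_nonneg _).trans (hφM x)) (hweight x)
  have hMβ : 0 ≤ M * β := mul_nonneg hM hβ₀.le
  have hbound (α' : ℝ) (h : Overlaps α' p q) :
      ∫ z, φ z ∂p - ∫ z, φ z ∂q ≤
        M * (2 * (1 - α') + β * (b * (ω x + ω y) + 2 * K)) := by
    have hsplit := h.integral_sub_le hφ hM (fun z => mul_nonneg hMβ (hω₀ z))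
      ((hωint x p hp).const_mul (M * β)) ((hωint y q hq).const_mul (M * β))
      fun z => (hφM z).trans_eq (by ring)
    rw [integral_const_mul, integral_const_mul] at hsplit
    linarith [mul_le_mul_of_nonneg_left (hdrift x p hp) hMβ,
      mul_le_mul_of_nonneg_left (hdrift y q hq) hMβ]
  suffices h : ∫ z, φ z ∂p - ∫ z, φ z ∂q ≤ M * (L * (2 + β * (ω x + ω y))) by linarith
  rcases le_total (ω x + ω y) R with hr | hr
  · exact (hbound α (hT x y (by linarith [hω₀ y]) (by linarith [hω₀ x]) p hp q hq)).trans
      (mul_le_mul_of_nonneg_left (hnear _ (add_nonneg (hω₀ x) (hω₀ y)) hr) hM)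
  · refine (hbound 0 (overlaps_zero p q)).trans (mul_le_mul_of_nonneg_left ?_ hM)
    linarith [hfar _ hr]

end Harris

/-! ### Tilted kernels -/

section TiltedMinorization

lemma exp_neg_mul_sub_le {z t φ N : ℝ} (hz : |z| ≤ t) (hφ : φ ∈ Set.Icc (0 : ℝ) 1) (hN : 0 < N) :
    Real.exp (-N) * (φ - t / N) ≤ Real.exp z * φ := by
  have ht : 0 ≤ t := (abs_nonneg z).trans hz
  rcases le_total t N with htN | htN
  · calc Real.exp (-N) * (φ - t / N) ≤ Real.exp (-N) * φ := by
          gcongr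
          exact sub_le_self _ (by positivity)
      _ ≤ Real.exp z * φ :=
          mul_le_mul_of_nonneg_right (Real.exp_le_exp.mpr (by linarith [(abs_le.mp hz).1])) hφ.1
  · have : 1 ≤ t / N := (one_le_div hN).mpr htN
    exact (mul_nonpos_of_nonneg_of_nonpos (Real.exp_pos _).le (by linarith [hφ.2])).trans
      (mul_nonneg (Real.exp_pos _).le hφ.1)

variable {S : Type*} [MeasurableSpace S] {ρ : Measure S} [IsProbabilityMeasure ρ] {Z t φ : S → ℝ}

lemma le_integral_tilted (hZ : Measurable Z) (hZt : ∀ w, |Z w| ≤ t w)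
    (hexp : Integrable (fun w => Real.exp (t w)) ρ) (ht : Integrable t ρ) (hφ : Measurable φ)
    (hφ₀₁ : ∀ w, φ w ∈ Set.Icc (0 : ℝ) 1) {N : ℝ} (hN : 0 < N) :
    Real.exp (-N) / (∫ w, Real.exp (t w) ∂ρ) * (∫ w, φ w ∂ρ - (∫ w, t w ∂ρ) / N) ≤
      ∫ w, φ w ∂(ρ.tilted Z) := by
  have hφint : Integrable φ ρ := integrable_of_abs_le hφ fun w =>
    abs_le.mpr ⟨by linarith [(hφ₀₁ w).1], (hφ₀₁ w).2⟩
  have hZle (w : S) : Real.exp (Z w) ≤ Real.exp (t w) :=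
    Real.exp_le_exp.mpr ((le_abs_self _).trans (hZt w))
  have hZint : Integrable (fun w => Real.exp (Z w)) ρ := hexp.mono' hZ.exp.aestronglyMeasurable
    (ae_of_all _ fun w => by rw [Real.norm_eq_abs, Real.abs_exp]; exact hZle w)
  have hnum : Integrable (fun w => Real.exp (Z w) * φ w) ρ :=
    hZint.mul_of_top_left (memLp_top_of_bound hφ.aestronglyMeasurable 1 (ae_of_all _ fun w => by
      rw [Real.norm_eq_abs, abs_of_nonneg (hφ₀₁ w).1]; exact (hφ₀₁ w).2))
  have hle : Real.exp (-N) * (∫ w, φ w ∂ρ - (∫ w, t w ∂ρ) / N) ≤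
      ∫ w, Real.exp (Z w) * φ w ∂ρ := by
    rw [← integral_div, ← integral_sub hφint (ht.div_const N), ← integral_const_mul]
    exact integral_mono ((hφint.sub (ht.div_const N)).const_mul _) hnum fun w =>
      exp_neg_mul_sub_le (hZt w) (hφ₀₁ w) hN
  rw [integral_tilted_eq_div, div_mul_eq_mul_div]
  calc _ ≤ (∫ w, Real.exp (Z w) * φ w ∂ρ) / ∫ w, Real.exp (t w) ∂ρ :=
        div_le_div_of_nonneg_right hle (integral_exp_pos hexp).le
    _ ≤ _ := div_le_div_of_nonneg_left
        (integral_nonneg fun w => mul_nonneg (Real.exp_pos _).le (hφ₀₁ w).1)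
        (integral_exp_pos hZint) (integral_mono hZint hexp hZle)

end TiltedMinorization

section WeightedKernel

variable {X S : Type*} [MeasurableSpace X] [MeasurableSpace S]

/-- The random map `x ↦ G (x, w)`, `w ∼ ρ`, is controlled by the weight `ω` and the envelope `s`
of the noise: `ω (G (x, w)) ≤ s w + b ω x` with `0 ≤ b < 1`. -/
structure IsWeightedKernel (ρ : Measure S) (s : S → ℝ) (G : X → S → X) (ω : X → ℝ) (b : ℝ) :
    Prop where
  measurable_map : Measurable fun p : X × S => G p.1 p.2
  measurable_weight : Measurable ω
  weight_nonneg : ∀ x, 0 ≤ ω x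
  envelope : IsExpEnvelope ρ s
  rate_nonneg : 0 ≤ b
  rate_lt_one : b < 1
  growth_map : ∀ x w, ω (G x w) ≤ s w + b * ω x

/-- Local minorization of the kernel `x ↦ law of G (x, ·)` on sublevel sets of `ω`. -/
def IsLocallyMinorized (ρ : Measure S) (G : X → S → X) (ω : X → ℝ) : Prop :=
  ∀ R : ℝ, 0 < R → ∃ c : ℝ, 0 < c ∧ ∃ ν : Measure X, IsProbabilityMeasure ν ∧
    ∀ x, ω x ≤ R → ENNReal.ofReal c • ν ≤ ρ.map (G x)

/-- An exponent of size `D` at the state `x`. The exponents `γ (F (x, h, ·) + f (G (x, ·)))` of the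
Bellman equation are of this form, with `D` of the order of `γ` and `γ f`. -/
def IsTilt (s : S → ℝ) (ω : X → ℝ) (D : ℝ) (x : X) (Z : S → ℝ) : Prop :=
  Measurable Z ∧ ∀ w, |Z w| ≤ D * (s w + ω x)

/-- The laws of the next state after `x` when the noise is tilted by an exponent of size `D`. -/
def tiltedLaws (ρ : Measure S) (s : S → ℝ) (G : X → S → X) (ω : X → ℝ) (D : ℝ) (x : X) :
    Set (Measure X) :=
  (fun Z => (ρ.tilted Z).map (G x)) '' {Z | IsTilt s ω D x Z}

variable {ρ : Measure S} {s Z : S → ℝ} {G : X → S → X} {ω : X → ℝ} {b D : ℝ} {x : X}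

lemma integral_comp_le_of_smul_le_map [IsProbabilityMeasure ρ] {g : S → X} (hg : Measurable g)
    {c : ℝ} (hc : 0 ≤ c) {ν : Measure X} (h : ENNReal.ofReal c • ν ≤ ρ.map g) {φ : X → ℝ}
    (hφ : Measurable φ) (hφ₀₁ : ∀ z, φ z ∈ Set.Icc (0 : ℝ) 1) :
    c * ∫ z, φ z ∂ν ≤ ∫ w, φ (g w) ∂ρ := by
  have : IsProbabilityMeasure (ρ.map g) := Measure.isProbabilityMeasure_map hg.aemeasurable
  have hint : Integrable φ (ρ.map g) := integrable_of_abs_le hφ fun z =>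
    abs_le.mpr ⟨by linarith [(hφ₀₁ z).1], (hφ₀₁ z).2⟩
  have hmono := integral_mono_measure h (ae_of_all _ fun z => (hφ₀₁ z).1) hint
  rwa [integral_smul_measure, ENNReal.toReal_ofReal hc, smul_eq_mul,
    integral_map hg.aemeasurable hφ.aestronglyMeasurable] at hmono

namespace IsWeightedKernel

lemma measurable_right (h : IsWeightedKernel ρ s G ω b) (x : X) : Measurable (G x) :=
  h.measurable_map.comp (measurable_const.prodMk measurable_id)

lemma dominated_of_isTilt (h : IsWeightedKernel ρ s G ω b) (hZ : IsTilt s ω D x Z) :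
    Dominated s Z :=
  h.envelope.dominated_of_abs_le hZ.1 fun w => (hZ.2 w).trans_eq (mul_add _ _ _)

lemma dominated_comp (h : IsWeightedKernel ρ s G ω b) {φ : X → ℝ} (hφ : Measurable φ) {C : ℝ}
    (hC : ∀ x, |φ x| ≤ C * (1 + ω x)) (x : X) : Dominated s (fun w => φ (G x w)) := by
  refine h.envelope.dominated_of_abs_le (C := |C|) (c := |C| * (1 + b * ω x))
    (hφ.comp (h.measurable_right x)) fun w => (hC _).trans ?_
  calc C * (1 + ω (G x w)) ≤ |C| * (1 + ω (G x w)) :=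
        mul_le_mul_of_nonneg_right (le_abs_self C) (by linarith [h.weight_nonneg (G x w)])
    _ ≤ |C| * (1 + (s w + b * ω x)) := by gcongr; exact h.growth_map x w
    _ = _ := by ring

lemma abs_weight_le (h : IsWeightedKernel ρ s G ω b) (x : X) : |ω x| ≤ 1 * (1 + ω x) := by
  rw [abs_of_nonneg (h.weight_nonneg x)]
  linarith

lemma dominated_weight (h : IsWeightedKernel ρ s G ω b) (x : X) :
    Dominated s (fun w => ω (G x w)) :=
  h.dominated_comp h.measurable_weight h.abs_weight_le x

lemma integrable_of_mem (h : IsWeightedKernel ρ s G ω b) {p : Measure X}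
    (hp : p ∈ tiltedLaws ρ s G ω D x) {φ : X → ℝ} (hφ : Measurable φ) {C : ℝ}
    (hC : ∀ x, |φ x| ≤ C * (1 + ω x)) : Integrable φ p := by
  obtain ⟨Z, hZ, rfl⟩ := hp
  exact (integrable_map_measure hφ.aestronglyMeasurable (h.measurable_right x).aemeasurable).mpr
    (h.envelope.integrable_tilted (h.dominated_of_isTilt hZ) (h.dominated_comp hφ hC x))

lemma integrable_weight_of_mem (h : IsWeightedKernel ρ s G ω b) {p : Measure X}
    (hp : p ∈ tiltedLaws ρ s G ω D x) : Integrable ω p :=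
  h.integrable_of_mem hp h.measurable_weight h.abs_weight_le

variable [IsProbabilityMeasure ρ]

lemma isProbabilityMeasure_of_mem (h : IsWeightedKernel ρ s G ω b) {p : Measure X}
    (hp : p ∈ tiltedLaws ρ s G ω D x) : IsProbabilityMeasure p := by
  obtain ⟨Z, hZ, rfl⟩ := hp
  have := isProbabilityMeasure_tilted (h.envelope.integrable_exp_of (h.dominated_of_isTilt hZ))
  exact Measure.isProbabilityMeasure_map (h.measurable_right x).aemeasurable

lemma exists_overlap (h : IsWeightedKernel ρ s G ω b) (hmin : IsLocallyMinorized ρ G ω)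
    (hD : 0 ≤ D) {R : ℝ} (hR : 0 < R) :
    ∃ α, 0 < α ∧ ∀ x y, ω x ≤ R → ω y ≤ R → ∀ p ∈ tiltedLaws ρ s G ω D x,
      ∀ q ∈ tiltedLaws ρ s G ω D y, Overlaps α p q := by
  obtain ⟨c, hc, ν, hν, hcν⟩ := hmin R hR
  set t : S → ℝ := fun w => D * s w + D * R
  have ht : Dominated s t :=
    (h.envelope.dominated.const_mul D).add (h.envelope.dominated_const (D * R))
  have ht₀ : 0 ≤ ∫ w, t w ∂ρ := integral_nonneg fun w => by have := h.envelope.pos w; positivity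
  have hexp : 0 < ∫ w, Real.exp (t w) ∂ρ := integral_exp_pos (h.envelope.integrable_exp_of ht)
  set N := 4 * (∫ w, t w ∂ρ) / c + 1
  have hN : 0 < N := by positivity
  have hNt : (∫ w, t w ∂ρ) / N ≤ c * (1 / 4) := by
    rw [div_le_iff₀ hN]
    have : c * (1 / 4) * N = ∫ w, t w ∂ρ + c / 4 := by simp only [N]; field_simp
    linarith
  set ε := Real.exp (-N) / (∫ w, Real.exp (t w) ∂ρ) * c with hε
  have hminor : ∀ x, ω x ≤ R → ∀ p ∈ tiltedLaws ρ s G ω D x, ∀ φ : X → ℝ, Measurable φ →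
      (∀ z, φ z ∈ Set.Icc 0 1) → ε * (∫ z, φ z ∂ν - 1 / 4) ≤ ∫ z, φ z ∂p := by
    rintro x hx _ ⟨Z, hZ, rfl⟩ φ hφ hφ₀₁
    have hG := h.measurable_right x
    have hZt (w : S) : |Z w| ≤ t w :=
      (hZ.2 w).trans (by simp only [t]; rw [← mul_add]; gcongr)
    rw [integral_map hG.aemeasurable hφ.aestronglyMeasurable]
    refine le_trans ?_ (le_integral_tilted hZ.1 hZt (h.envelope.integrable_exp_of ht)
      (h.envelope.integrable_of ht) (hφ.comp hG) (fun w => hφ₀₁ _) hN)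
    rw [hε, mul_assoc, mul_sub]
    have hcφ := integral_comp_le_of_smul_le_map hG hc.le (hcν x hx) hφ hφ₀₁
    gcongr
    exact hcφ
  refine ⟨ε / 2, by positivity, fun x y hx hy p hp q hq => ?_⟩
  have := h.isProbabilityMeasure_of_mem hp
  have := h.isProbabilityMeasure_of_mem hq
  exact overlaps_of_minorized (hminor x hx p hp) (hminor y hy q hq)

lemma logLaplace_add_isTilt_le (h : IsWeightedKernel ρ s G ω b) (hZ : IsTilt s ω D x Z) (θ : ℝ) :
    logLaplace ρ (fun w => θ * s w + Z w) ≤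
      logLaplace ρ (fun w => (θ + D) * s w) + D * ω x := by
  have hs := h.envelope.dominated
  rw [← logLaplace_add_const (h.envelope.integrable_exp (θ + D))]
  refine logLaplace_mono
    (h.envelope.integrable_exp_of ((hs.const_mul θ).add (h.dominated_of_isTilt hZ)))
    (h.envelope.integrable_exp_of ((hs.const_mul (θ + D)).add (h.envelope.dominated_const _)))
    fun w => ?_
  linarith [(abs_le.mp (hZ.2 w)).2]

lemma neg_le_logLaplace_of_isTilt (h : IsWeightedKernel ρ s G ω b) (hZ : IsTilt s ω D x Z) :
    -(D * ∫ w, s w ∂ρ + D * ω x) ≤ logLaplace ρ Z := by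
  have hdom := h.dominated_of_isTilt hZ
  have hs := h.envelope.integrable_of h.envelope.dominated
  calc -(D * ∫ w, s w ∂ρ + D * ω x) = ∫ w, -(D * (s w + ω x)) ∂ρ := by
        rw [integral_neg, integral_const_mul, integral_add hs (integrable_const _)]
        simp [mul_add]
    _ ≤ ∫ w, Z w ∂ρ := integral_mono ((hs.add (integrable_const _)).const_mul D).neg
        (h.envelope.integrable_of hdom) fun w => (abs_le.mp (hZ.2 w)).1
    _ ≤ logLaplace ρ Z := integral_le_logLaplace (h.envelope.integrable_exp_of hdom)
        (h.envelope.integrable_of hdom)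

/-- By the Gibbs inequality with the exponent `θ s`, the tilt costs at most `2 D ω x / θ`, which is
a small multiple of `ω x` for large `θ`. -/
lemma exists_drift (h : IsWeightedKernel ρ s G ω b) (hD : 0 ≤ D) :
    ∃ K, 0 ≤ K ∧ ∀ x, ∀ p ∈ tiltedLaws ρ s G ω D x, ∫ z, ω z ∂p ≤ (1 + b) / 2 * ω x + K := by
  have hb : 0 < 1 - b := sub_pos.mpr h.rate_lt_one
  set θ := 4 * D / (1 - b) + 1
  have hθ : 0 < θ := by positivity
  have hDθ : 2 * D ≤ (1 - b) / 2 * θ := by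
    have : (1 - b) / 2 * θ = 2 * D + (1 - b) / 2 := by simp only [θ]; field_simp; ring
    linarith
  set T := logLaplace ρ (fun w => (θ + D) * s w) + D * ∫ w, s w ∂ρ
  refine ⟨|T| / θ, by positivity, ?_⟩
  rintro x _ ⟨Z, hZ, rfl⟩
  have hs := h.envelope.dominated
  have hdom := h.dominated_of_isTilt hZ
  have := isProbabilityMeasure_tilted (h.envelope.integrable_exp_of hdom)
  have hsint := h.envelope.integrable_tilted hdom hs
  have hGibbs := integral_tilted_sub_le (Z₁ := fun w => θ * s w + Z w)
    (h.envelope.integrable_exp_of ((hs.const_mul θ).add hdom)) (h.envelope.integrable_exp_of hdom)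
    (h.envelope.integrable_tilted hdom (((hs.const_mul θ).add hdom).sub hdom))
  simp only [add_sub_cancel_right, integral_const_mul] at hGibbs
  have htilted : ∫ w, s w ∂(ρ.tilted Z) ≤ (1 - b) / 2 * ω x + |T| / θ := by
    refine le_of_mul_le_mul_left (hGibbs.trans ?_) hθ
    rw [mul_add, mul_div_cancel₀ _ hθ.ne']
    linarith [h.logLaplace_add_isTilt_le hZ θ, h.neg_le_logLaplace_of_isTilt hZ, le_abs_self T,
      mul_le_mul_of_nonneg_right hDθ (h.weight_nonneg x)]
  rw [integral_map (h.measurable_right x).aemeasurable h.measurable_weight.aestronglyMeasurable]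
  calc ∫ w, ω (G x w) ∂(ρ.tilted Z) ≤ ∫ w, (s w + b * ω x) ∂(ρ.tilted Z) :=
        integral_mono (h.envelope.integrable_tilted hdom (h.dominated_weight x))
          (hsint.add (integrable_const _)) fun w => h.growth_map x w
    _ = ∫ w, s w ∂(ρ.tilted Z) + b * ω x := by
        rw [integral_add hsint (integrable_const _)]; simp
    _ ≤ _ := by linarith

theorem exists_tilted_contraction (h : IsWeightedKernel ρ s G ω b)
    (hmin : IsLocallyMinorized ρ G ω) (hD : 0 ≤ D) :
    ∃ β L : ℝ, 0 < β ∧ β ≤ 1 ∧ 0 ≤ L ∧ L < 1 ∧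
      ∀ x y, ∀ p ∈ tiltedLaws ρ s G ω D x, ∀ q ∈ tiltedLaws ρ s G ω D y,
        ∀ φ : X → ℝ, Measurable φ → ∀ M, (∀ z, |φ z| ≤ M * (1 + β * ω z)) →
          ∫ z, φ z ∂p - ∫ z, φ z ∂q ≤ L * (M * (2 + β * ω x + β * ω y)) := by
  obtain ⟨K, hK, hdrift⟩ := h.exists_drift hD
  exact exists_weighted_contraction (fun x p hp => h.isProbabilityMeasure_of_mem hp)
    h.weight_nonneg (fun x p hp => h.integrable_weight_of_mem hp) (by linarith [h.rate_lt_one]) hK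
    hdrift (fun R hR => h.exists_overlap hmin hD hR)

end IsWeightedKernel

end WeightedKernel

/-! ### Relative fixed points of operators contracting the oscillation -/

section Oscillation

variable {X : Type*} {ω : X → ℝ} {β M M' : ℝ} {φ ψ : X → ℝ} {x₀ : X}

/-- `M` bounds the `β`-weighted oscillation of `φ`. On functions modulo constants, the least such
`M` is the seminorm dual to the weighted total variation distance with weight `1 + β ω`. -/
def OscBound (ω : X → ℝ) (β M : ℝ) (φ : X → ℝ) : Prop :=
  ∀ x y, φ x - φ y ≤ M * (2 + β * ω x + β * ω y)

namespace OscBound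

lemma add (hφ : OscBound ω β M φ) (hψ : OscBound ω β M' ψ) :
    OscBound ω β (M + M') (fun x => φ x + ψ x) := fun x y => by
  linarith [hφ x y, hψ x y]

lemma neg (hφ : OscBound ω β M φ) : OscBound ω β M (fun x => -φ x) := fun x y => by
  linarith [hφ y x]

lemma add_const (hφ : OscBound ω β M φ) (c : ℝ) : OscBound ω β M (fun x => φ x + c) :=
  fun x y => by linarith [hφ x y]

lemma abs_sub_le (hφ : OscBound ω β M φ) (x y : X) :
    |φ x - φ y| ≤ M * (2 + β * ω x + β * ω y) :=
  abs_le.mpr ⟨by linarith [hφ y x], hφ x y⟩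

lemma exists_center [Nonempty X] (hφ : OscBound ω β M φ) :
    ∃ c, ∀ z, |φ z - c| ≤ M * (1 + β * ω z) := by
  have hle (x y : X) : φ x - M * (1 + β * ω x) ≤ φ y + M * (1 + β * ω y) := by
    linarith [hφ x y]
  refine ⟨⨅ y, (φ y + M * (1 + β * ω y)), fun z => ?_⟩
  have hupper : ⨅ y, (φ y + M * (1 + β * ω y)) ≤ φ z + M * (1 + β * ω z) :=
    ciInf_le ⟨φ z - M * (1 + β * ω z), by rintro _ ⟨y, rfl⟩; exact hle z y⟩ z
  have hlower : φ z - M * (1 + β * ω z) ≤ ⨅ y, (φ y + M * (1 + β * ω y)) := le_ciInf (hle z)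
  rw [abs_le]
  constructor <;> linarith

lemma abs_le_of_eq_zero (hφ : OscBound ω β M φ) (hM : 0 ≤ M) (hβ : β ≤ 1) (hω : ∀ x, 0 ≤ ω x)
    (h₀ : φ x₀ = 0) (x : X) : |φ x| ≤ M * (2 + ω x₀) * (1 + ω x) := by
  have h := hφ.abs_sub_le x x₀
  rw [h₀, sub_zero] at h
  refine h.trans ?_
  rw [mul_assoc]
  refine mul_le_mul_of_nonneg_left ?_ hM
  nlinarith [hω x, hω x₀, mul_nonneg (hω x₀) (hω x)]

lemma eq_of_tendsto_zero {ε : ℕ → ℝ} (hε : Tendsto ε atTop (nhds 0))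
    (h : ∀ n, OscBound ω β (ε n) φ) (x y : X) : φ x = φ y := by
  have hlim := hε.mul_const (2 + β * ω x + β * ω y)
  rw [zero_mul] at hlim
  exact sub_eq_zero.mp (abs_nonpos_iff.mp (ge_of_tendsto' hlim fun n => (h n).abs_sub_le x y))

lemma continuous_of_tendsto_zero [TopologicalSpace X] (hω : Continuous ω) (hβ : 0 ≤ β)
    {ε : ℕ → ℝ} (hε : Tendsto ε atTop (nhds 0)) (hε₀ : ∀ n, 0 ≤ ε n) {f : ℕ → X → ℝ} {v : X → ℝ}
    (hf : ∀ n, Continuous (f n)) (hf₀ : ∀ n, f n x₀ = v x₀)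
    (h : ∀ n, OscBound ω β (ε n) (fun x => v x - f n x)) : Continuous v := by
  refine TendstoLocallyUniformly.continuous (F := f) (p := atTop) ?_ (Frequently.of_forall hf)
  rw [Metric.tendstoLocallyUniformly_iff]
  intro δ hδ x
  refine ⟨{y | ω y < ω x + 1}, hω.continuousAt.eventually_lt continuousAt_const (lt_add_one _), ?_⟩
  have hlim := hε.mul_const (2 + β * (ω x + 1) + β * ω x₀)
  rw [zero_mul] at hlim
  filter_upwards [hlim.eventually_lt_const hδ] with n hn y hy
  have hdist := (h n).abs_sub_le y x₀
  rw [hf₀, sub_self, sub_zero] at hdist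
  rw [Real.dist_eq]
  refine (hdist.trans (mul_le_mul_of_nonneg_left ?_ (hε₀ n))).trans_lt hn
  have : β * ω y ≤ β * (ω x + 1) := mul_le_mul_of_nonneg_left (le_of_lt hy) hβ
  linarith

lemma exists_limit {L : ℝ} (hL : L < 1) {f : ℕ → X → ℝ} (hf₀ : ∀ n, f n x₀ = 0)
    (h : ∀ n, OscBound ω β (M * L ^ n) (fun x => f (n + 1) x - f n x)) :
    ∃ v : X → ℝ, (∀ x, Tendsto (fun n => f n x) atTop (nhds (v x))) ∧
      ∀ n, OscBound ω β (M / (1 - L) * L ^ n) (fun x => v x - f n x) := by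
  have hdist (x y : X) (n : ℕ) : dist (f n x - f n y) (f (n + 1) x - f (n + 1) y) ≤
      M * (2 + β * ω x + β * ω y) * L ^ n := by
    rw [dist_comm, Real.dist_eq, sub_sub_sub_comm]
    exact ((h n).abs_sub_le x y).trans_eq (mul_right_comm _ _ _)
  have hcauchy (x : X) : CauchySeq fun n => f n x := by
    simpa only [hf₀, sub_zero] using cauchySeq_of_le_geometric L _ hL (hdist x x₀)
  choose v hv using fun x => cauchySeq_tendsto_of_complete (hcauchy x)
  refine ⟨v, hv, fun n x y => ?_⟩
  have hle := dist_le_of_le_geometric_of_tendsto L _ hL (hdist x y) ((hv x).sub (hv y)) n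
  rw [dist_comm, Real.dist_eq, sub_sub_sub_comm] at hle
  exact ((le_abs_self _).trans hle).trans_eq (by ring)

end OscBound

end Oscillation

section RelativeFixedPoint

variable {X : Type*} [TopologicalSpace X] {ω : X → ℝ} {β L M : ℝ} {x₀ : X}
  {T : (X → ℝ) → X → ℝ} {f : X → ℝ}

/-- The continuous functions normalized by `f x₀ = 0` with weighted oscillation at most `M`. -/
def oscBall (ω : X → ℝ) (β M : ℝ) (x₀ : X) : Set (X → ℝ) :=
  {f | Continuous f ∧ f x₀ = 0 ∧ OscBound ω β M f}

/-- `T` contracts the weighted oscillation on `oscBall ω β M x₀` by the factor `L`, and `T 0` is so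
small that `T`, normalized at `x₀`, maps this ball into itself. -/
structure IsOscContraction (T : (X → ℝ) → X → ℝ) (ω : X → ℝ) (β L M : ℝ) (x₀ : X) : Prop where
  continuous : ∀ f ∈ oscBall ω β M x₀, Continuous (T f)
  contracts : ∀ f ∈ oscBall ω β M x₀, ∀ g ∈ oscBall ω β M x₀, ∀ m,
    OscBound ω β m (fun x => f x - g x) → OscBound ω β (L * m) (fun x => T f x - T g x)
  map_zero : OscBound ω β ((1 - L) * M) (T 0)

/-- Relative value iteration: the iterates of `f ↦ T f - T f x₀` started at `0`. -/
def relativeIteration (T : (X → ℝ) → X → ℝ) (x₀ : X) : ℕ → X → ℝ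
  | 0 => 0
  | n + 1 => fun x => T (relativeIteration T x₀ n) x - T (relativeIteration T x₀ n) x₀

lemma zero_mem_oscBall (hω : ∀ x, 0 ≤ ω x) (hβ : 0 ≤ β) (hM : 0 ≤ M) : 0 ∈ oscBall ω β M x₀ := by
  refine ⟨continuous_const, rfl, fun x y => ?_⟩
  have := hω x
  have := hω y
  simp only [Pi.zero_apply, sub_zero]
  positivity

namespace IsOscContraction

lemma normalize_mem (hT : IsOscContraction T ω β L M x₀) (h₀ : 0 ∈ oscBall ω β M x₀)
    (hf : f ∈ oscBall ω β M x₀) : (fun x => T f x - T f x₀) ∈ oscBall ω β M x₀ := by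
  refine ⟨(hT.continuous f hf).sub continuous_const, sub_self _, fun x y => ?_⟩
  have hosc := (hT.contracts f hf 0 h₀ M (by simpa using hf.2.2)).add hT.map_zero x y
  simp only [sub_add_cancel] at hosc
  linarith

lemma relativeIteration_mem (hT : IsOscContraction T ω β L M x₀) (h₀ : 0 ∈ oscBall ω β M x₀)
    (n : ℕ) : relativeIteration T x₀ n ∈ oscBall ω β M x₀ := by
  induction n with
  | zero => exact h₀
  | succ n ih => exact hT.normalize_mem h₀ ih

lemma oscBound_relativeIteration_sub (hT : IsOscContraction T ω β L M x₀)
    (h₀ : 0 ∈ oscBall ω β M x₀) (n : ℕ) : OscBound ω β (M * L ^ n)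
      (fun x => relativeIteration T x₀ (n + 1) x - relativeIteration T x₀ n x) := by
  induction n with
  | zero => simpa [relativeIteration] using (hT.relativeIteration_mem h₀ 1).2.2
  | succ n ih =>
    have hosc := hT.contracts _ (hT.relativeIteration_mem h₀ (n + 1)) _
      (hT.relativeIteration_mem h₀ n) _ ih
    rw [pow_succ', mul_left_comm]
    intro x y
    simp only [relativeIteration] at hosc ⊢
    linarith [hosc x y]

theorem exists_relative_fixedPoint (hT : IsOscContraction T ω β L M x₀) (hωc : Continuous ω)
    (hω : ∀ x, 0 ≤ ω x) (hβ : 0 ≤ β) (hM : 0 ≤ M) (hL₀ : 0 ≤ L) (hL₁ : L < 1) :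
    ∃ v ∈ oscBall ω β M x₀, ∀ x, v x + T v x₀ = T v x := by
  set f := relativeIteration T x₀
  have h₀ : 0 ∈ oscBall ω β M x₀ := zero_mem_oscBall hω hβ hM
  have hf (n : ℕ) : f n ∈ oscBall ω β M x₀ := hT.relativeIteration_mem h₀ n
  obtain ⟨v, hlim, hosc⟩ :=
    OscBound.exists_limit hL₁ (fun n => (hf n).2.1) (hT.oscBound_relativeIteration_sub h₀)
  set ε : ℕ → ℝ := fun n => M / (1 - L) * L ^ n
  have hε : Tendsto ε atTop (nhds 0) := by
    simpa using (tendsto_pow_atTop_nhds_zero_of_lt_one hL₀ hL₁).const_mul (M / (1 - L))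
  have hε₀ (n : ℕ) : 0 ≤ ε n :=
    mul_nonneg (div_nonneg hM (sub_nonneg.mpr hL₁.le)) (pow_nonneg hL₀ n)
  have hvx₀ : v x₀ = 0 := tendsto_nhds_unique (hlim x₀) (by simp [(hf _).2.1])
  have hv : v ∈ oscBall ω β M x₀ :=
    ⟨OscBound.continuous_of_tendsto_zero hωc hβ hε hε₀ (fun n => (hf n).1)
      (fun n => (hf n).2.1.trans hvx₀.symm) hosc, hvx₀,
      fun x y => le_of_tendsto' ((hlim x).sub (hlim y)) fun n => (hf n).2.2 x y⟩
  have hdefect (n : ℕ) : OscBound ω β (L * ε n + ε (n + 1)) (fun x => T v x - v x) := by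
    have hsum := ((hT.contracts v hv _ (hf n) _ (hosc n)).add (hosc (n + 1)).neg).add_const
      (T (f n) x₀)
    convert hsum using 2 with x
    change _ = T v x - T (f n) x + -(v x - (T (f n) x - T (f n) x₀)) + T (f n) x₀
    ring
  have hdefect_lim : Tendsto (fun n => L * ε n + ε (n + 1)) atTop (nhds 0) := by
    simpa using (hε.const_mul L).add (hε.comp (tendsto_add_atTop_nat 1))
  refine ⟨v, hv, fun x => ?_⟩
  have := OscBound.eq_of_tendsto_zero hdefect_lim hdefect x x₀
  linarith

end IsOscContraction

end RelativeFixedPoint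

/-! ### The Bellman operator -/

section Growth

variable {X : Type*} [TopologicalSpace X] {ω : X → ℝ} {C : ℝ} {f g : X → ℝ}

/-- `f` is a continuous function with `ω`-norm at most `C`. -/
structure GrowsLinearly (ω : X → ℝ) (C : ℝ) (f : X → ℝ) : Prop where
  continuous : Continuous f
  abs_le : ∀ x, |f x| ≤ C * (1 + ω x)

lemma growsLinearly_zero : GrowsLinearly ω 0 0 := ⟨continuous_const, fun x => by simp⟩

lemma GrowsLinearly.nonneg [Nonempty X] (hf : GrowsLinearly ω C f) (hω : ∀ x, 0 ≤ ω x) :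
    0 ≤ C := by
  obtain ⟨x⟩ := ‹Nonempty X›
  exact nonneg_of_mul_nonneg_left ((abs_nonneg _).trans (hf.abs_le x)) (by linarith [hω x])

lemma GrowsLinearly.mono {C' : ℝ} (hf : GrowsLinearly ω C f) (hω : ∀ x, 0 ≤ ω x) (h : C ≤ C') :
    GrowsLinearly ω C' f :=
  ⟨hf.continuous, fun x => (hf.abs_le x).trans
    (mul_le_mul_of_nonneg_right h (by linarith [hω x]))⟩

lemma GrowsLinearly.sub {C' : ℝ} (hf : GrowsLinearly ω C f) (hg : GrowsLinearly ω C' g) :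
    GrowsLinearly ω (C + C') (fun x => f x - g x) :=
  ⟨hf.continuous.sub hg.continuous, fun x => (abs_sub _ _).trans
    ((add_le_add (hf.abs_le x) (hg.abs_le x)).trans_eq (add_mul _ _ _).symm)⟩

end Growth

section Bellman

variable {X A S : Type*} [TopologicalSpace X] [MeasurableSpace X] [TopologicalSpace A]
  [MeasurableSpace A] [MeasurableSpace S]

/-- A controlled system with transition map `G` and one-period reward `F`, both continuous in the
state (and control) and growing at most linearly in the weight `ω`, with the noise entering through
the envelope `s`. -/
structure IsControlModel (ρ : Measure S) (s : S → ℝ) (G : X → S → X) (F : X → A → S → ℝ)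
    (ω : X → ℝ) (b₁ b₂ : ℝ) : Prop extends IsWeightedKernel ρ s G ω b₁ where
  continuous_map : ∀ w, Continuous fun x => G x w
  continuous_weight : Continuous ω
  measurable_reward : Measurable fun p : X × A × S => F p.1 p.2.1 p.2.2
  continuous_reward : ∀ w, Continuous fun p : X × A => F p.1 p.2 w
  reward_rate_nonneg : 0 ≤ b₂
  growth_reward : ∀ x h w, |F x h w| ≤ s w + b₂ * ω x

/-- The real-valued entropic utility `μ^γ (F (x, h, ·) + f (G (x, ·)))`. -/
noncomputable def util (ρ : Measure S) (G : X → S → X) (F : X → A → S → ℝ) (γ : ℝ) (f : X → ℝ)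
    (x : X) (h : A) : ℝ :=
  γ⁻¹ * logLaplace ρ fun w => γ * (F x h w + f (G x w))

/-- The Bellman operator `f ↦ sup_h μ^γ (F (x, h, ·) + f (G (x, ·)))`. -/
noncomputable def bellman (ρ : Measure S) (G : X → S → X) (F : X → A → S → ℝ) (γ : ℝ) (f : X → ℝ)
    (x : X) : ℝ :=
  ⨆ h, util ρ G F γ f x h

variable {ρ : Measure S} {s : S → ℝ} {G : X → S → X} {F : X → A → S → ℝ} {ω : X → ℝ}
  {b₁ b₂ C C' D γ : ℝ} {f g : X → ℝ}

namespace IsControlModel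

lemma measurable_reward_right (hM : IsControlModel ρ s G F ω b₁ b₂) (x : X) (h : A) :
    Measurable (F x h) :=
  hM.measurable_reward.comp (measurable_const.prodMk (measurable_const.prodMk measurable_id))

lemma abs_reward_add_le (hM : IsControlModel ρ s G F ω b₁ b₂) (hf : GrowsLinearly ω C f)
    (x : X) (h : A) (w : S) :
    |F x h w + f (G x w)| ≤ (1 + C) * s w + (C + (b₂ + C * b₁) * ω x) := by
  have : Nonempty X := ⟨x⟩
  calc |F x h w + f (G x w)| ≤ |F x h w| + |f (G x w)| := abs_add_le _ _
    _ ≤ (s w + b₂ * ω x) + C * (1 + ω (G x w)) :=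
        add_le_add (hM.growth_reward x h w) (hf.abs_le _)
    _ ≤ (s w + b₂ * ω x) + C * (1 + (s w + b₁ * ω x)) := by
        have := hf.nonneg hM.weight_nonneg
        gcongr
        exact hM.growth_map x w
    _ = _ := by ring

variable [BorelSpace X]

lemma measurable_exponent (hM : IsControlModel ρ s G F ω b₁ b₂) (hf : Continuous f) (γ : ℝ) (x : X)
    (h : A) : Measurable fun w => γ * (F x h w + f (G x w)) :=
  ((hM.measurable_reward_right x h).add (hf.measurable.comp (hM.measurable_right x))).const_mul γ

lemma dominated_exponent (hM : IsControlModel ρ s G F ω b₁ b₂) (hf : GrowsLinearly ω C f) (γ : ℝ)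
    (x : X) (h : A) : Dominated s fun w => γ * (F x h w + f (G x w)) := by
  refine (hM.envelope.dominated_of_abs_le ?_ (hM.abs_reward_add_le hf x h)).const_mul γ
  simpa using hM.measurable_exponent hf.continuous 1 x h

lemma integrable_exp_exponent (hM : IsControlModel ρ s G F ω b₁ b₂) (hf : GrowsLinearly ω C f)
    (γ : ℝ) (x : X) (h : A) : Integrable (fun w => Real.exp (γ * (F x h w + f (G x w)))) ρ :=
  hM.envelope.integrable_exp_of (hM.dominated_exponent hf γ x h)

lemma isTilt_exponent (hM : IsControlModel ρ s G F ω b₁ b₂) (hf : GrowsLinearly ω C f)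
    (hγ : |γ| ≤ D) (hγC : |γ| * C ≤ D) (x : X) (h : A) :
    IsTilt s ω ((3 + b₂) * D) x fun w => γ * (F x h w + f (G x w)) := by
  refine ⟨hM.measurable_exponent hf.continuous γ x h, fun w => ?_⟩
  have hω := hM.weight_nonneg x
  have hb₂ := hM.reward_rate_nonneg
  have hb₁ := hM.rate_lt_one.le
  have hs := hM.envelope.one_le w
  have hb₁₀ := hM.rate_nonneg
  have hD : 0 ≤ D := (abs_nonneg γ).trans hγ
  calc |γ * (F x h w + f (G x w))|
      ≤ |γ| * ((1 + C) * s w + (C + (b₂ + C * b₁) * ω x)) := by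
        rw [abs_mul]
        exact mul_le_mul_of_nonneg_left (hM.abs_reward_add_le hf x h w) (abs_nonneg γ)
    _ = (|γ| + |γ| * C) * s w + (|γ| * C * 1 + (|γ| * b₂ + |γ| * C * b₁) * ω x) := by ring
    _ ≤ (D + D) * s w + (D * s w + (D * b₂ + D * 1) * ω x) := by gcongr
    _ ≤ (D + D) * s w + (D * s w + (D * b₂ + D * 1) * ω x) + (D * b₂ * s w + 2 * D * ω x) :=
        le_add_of_nonneg_right (by positivity)
    _ = _ := by ring

variable [IsProbabilityMeasure ρ]

lemma util_add_const (hM : IsControlModel ρ s G F ω b₁ b₂) (hγ : γ ≠ 0)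
    (hf : GrowsLinearly ω C f) (c : ℝ) (x : X) (h : A) :
    util ρ G F γ (fun z => f z + c) x h = util ρ G F γ f x h + c := by
  simp only [util, ← add_assoc, mul_add _ _ c]
  rw [logLaplace_add_const (hM.integrable_exp_exponent hf γ x h), mul_add, inv_mul_cancel_left₀ hγ]

lemma util_sub_le (hM : IsControlModel ρ s G F ω b₁ b₂) (hγ : γ < 0) (hf : GrowsLinearly ω C f)
    (hg : GrowsLinearly ω C' g) (x : X) (h : A) :
    util ρ G F γ f x h - util ρ G F γ g x h ≤
      ∫ w, (f (G x w) - g (G x w)) ∂(ρ.tilted fun w => γ * (F x h w + g (G x w))) := by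
  have hGibbs := integral_tilted_sub_le (hM.integrable_exp_exponent hf γ x h)
    (hM.integrable_exp_exponent hg γ x h) (hM.envelope.integrable_tilted
      (hM.dominated_exponent hg γ x h)
      ((hM.dominated_exponent hf γ x h).sub (hM.dominated_exponent hg γ x h)))
  simp only [← mul_sub, add_sub_add_left_eq_sub, integral_const_mul] at hGibbs
  rw [util, util, ← mul_sub, ← div_eq_inv_mul, div_le_iff_of_neg hγ]
  linarith

section Continuity

variable [FirstCountableTopology X] [FirstCountableTopology A]

lemma continuous_util (hM : IsControlModel ρ s G F ω b₁ b₂) (hf : GrowsLinearly ω C f) (γ : ℝ) :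
    Continuous fun p : X × A => util ρ G F γ f p.1 p.2 := by
  refine continuous_const.mul (Continuous.log (continuous_iff_continuousAt.mpr fun p => ?_)
    fun p => (integral_exp_pos (hM.integrable_exp_exponent hf γ p.1 p.2)).ne')
  have : Nonempty X := ⟨p.1⟩
  have hC := hf.nonneg hM.weight_nonneg
  have hbound : Dominated s fun w =>
      |γ| * ((1 + C) * s w + (C + (b₂ + C * b₁) * (ω p.1 + 1))) :=
    ((hM.envelope.dominated.const_mul _).add (hM.envelope.dominated_const _)).const_mul _
  refine continuousAt_of_dominated (Eventually.of_forall fun q =>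
    (hM.measurable_exponent hf.continuous γ q.1 q.2).exp.aestronglyMeasurable) ?_
    (hM.envelope.integrable_exp_of hbound) (ae_of_all _ fun w => ?_)
  · have hnear : ∀ᶠ q : X × A in nhds p, ω q.1 < ω p.1 + 1 :=
      (hM.continuous_weight.comp continuous_fst).continuousAt.eventually_lt continuousAt_const
        (lt_add_one _)
    filter_upwards [hnear] with q hq
    refine ae_of_all _ fun w => ?_
    rw [Real.norm_eq_abs, Real.abs_exp, Real.exp_le_exp]
    refine (le_abs_self _).trans ?_
    rw [abs_mul]
    refine mul_le_mul_of_nonneg_left ((hM.abs_reward_add_le hf q.1 q.2 w).trans ?_) (abs_nonneg γ)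
    have := hM.reward_rate_nonneg
    have := hM.rate_nonneg
    gcongr
  · exact (Real.continuous_exp.comp (continuous_const.mul ((hM.continuous_reward w).add
      (hf.continuous.comp ((hM.continuous_map w).comp continuous_fst))))).continuousAt

lemma continuous_util_right (hM : IsControlModel ρ s G F ω b₁ b₂) (hf : GrowsLinearly ω C f)
    (γ : ℝ) (x : X) : Continuous (util ρ G F γ f x) :=
  (hM.continuous_util hf γ).comp (Continuous.prodMk_right x)

variable [CompactSpace A]

lemma continuous_bellman (hM : IsControlModel ρ s G F ω b₁ b₂) (hf : GrowsLinearly ω C f) (γ : ℝ) :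
    Continuous (bellman ρ G F γ f) := by
  have h : Continuous fun x => sSup (util ρ G F γ f x '' Set.univ) :=
    isCompact_univ.continuous_sSup (hM.continuous_util hf γ)
  simp only [Set.image_univ] at h
  exact h

lemma util_le_bellman (hM : IsControlModel ρ s G F ω b₁ b₂) (hf : GrowsLinearly ω C f) (γ : ℝ)
    (x : X) (h : A) : util ρ G F γ f x h ≤ bellman ρ G F γ f x :=
  le_ciSup (isCompact_range (hM.continuous_util_right hf γ x)).bddAbove h

variable [Nonempty A]

lemma exists_bellman_eq (hM : IsControlModel ρ s G F ω b₁ b₂) (hf : GrowsLinearly ω C f) (γ : ℝ)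
    (x : X) : ∃ h, bellman ρ G F γ f x = util ρ G F γ f x h := by
  obtain ⟨h, -, hmax⟩ := isCompact_univ.exists_sSup_image_eq Set.univ_nonempty
    (hM.continuous_util_right hf γ x).continuousOn
  exact ⟨h, by rwa [Set.image_univ] at hmax⟩

lemma bellman_add_const (hM : IsControlModel ρ s G F ω b₁ b₂) (hγ : γ ≠ 0)
    (hf : GrowsLinearly ω C f) (c : ℝ) (x : X) :
    bellman ρ G F γ (fun z => f z + c) x = bellman ρ G F γ f x + c := by
  simp only [bellman, hM.util_add_const hγ hf]
  exact (ciSup_add (isCompact_range (hM.continuous_util_right hf γ x)).bddAbove c).symm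

lemma exists_bellman_sub_le (hM : IsControlModel ρ s G F ω b₁ b₂) (hγ : γ < 0) (hγD : |γ| ≤ D)
    (hf : GrowsLinearly ω C f) (hg : GrowsLinearly ω C' g) (hgD : |γ| * C' ≤ D) (x : X) :
    ∃ p ∈ tiltedLaws ρ s G ω ((3 + b₂) * D) x,
      bellman ρ G F γ f x - bellman ρ G F γ g x ≤ ∫ z, (f z - g z) ∂p := by
  obtain ⟨h, hmax⟩ := hM.exists_bellman_eq hf γ x
  refine ⟨_, ⟨_, hM.isTilt_exponent hg hγD hgD x h, rfl⟩, ?_⟩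
  beta_reduce
  rw [integral_map (hM.measurable_right x).aemeasurable
    (hf.sub hg).continuous.measurable.aestronglyMeasurable, hmax]
  linarith [hM.util_sub_le hγ hf hg x h, hM.util_le_bellman hg γ x h]

theorem exists_bellman_contraction [Nonempty X] (hM : IsControlModel ρ s G F ω b₁ b₂)
    (hmin : IsLocallyMinorized ρ G ω) (hD : 0 ≤ D) :
    ∃ β L : ℝ, 0 < β ∧ β ≤ 1 ∧ 0 ≤ L ∧ L < 1 ∧ ∀ γ < 0, |γ| ≤ D → ∀ C, |γ| * C ≤ D →
      ∀ f g, GrowsLinearly ω C f → GrowsLinearly ω C g →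
        ∀ M, OscBound ω β M (fun x => f x - g x) →
          OscBound ω β (L * M) (fun x => bellman ρ G F γ f x - bellman ρ G F γ g x) := by
  have hb₂ := hM.reward_rate_nonneg
  obtain ⟨β, L, hβ, hβ1, hL, hL1, hcon⟩ :=
    hM.exists_tilted_contraction hmin (D := (3 + b₂) * D) (by positivity)
  refine ⟨β, L, hβ, hβ1, hL, hL1, fun γ hγ hγD C hC f g hf hg M hosc x y => ?_⟩
  obtain ⟨c, hc⟩ := hosc.exists_center
  obtain ⟨p, hp, hpx⟩ := hM.exists_bellman_sub_le hγ hγD hf hg hC x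
  obtain ⟨q, hq, hqy⟩ := hM.exists_bellman_sub_le hγ hγD hg hf hC y
  have := hM.isProbabilityMeasure_of_mem hp
  have := hM.isProbabilityMeasure_of_mem hq
  have hsub := hf.sub hg
  have hle := hcon x y p hp q hq _ (hsub.continuous.measurable.sub_const c) M hc
  rw [integral_sub (hM.integrable_of_mem hp hsub.continuous.measurable hsub.abs_le)
      (integrable_const c),
    integral_sub (hM.integrable_of_mem hq hsub.continuous.measurable hsub.abs_le)
      (integrable_const c)] at hle
  simp only [integral_const, probReal_univ, smul_eq_mul, one_mul] at hle
  have hswap : ∫ z, (g z - f z) ∂q = -∫ z, (f z - g z) ∂q := by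
    rw [← integral_neg]
    simp only [neg_sub]
  linarith

end Continuity

end IsControlModel

end Bellman

/-! ### The Bellman equation -/

section BellmanEquation

lemma oscBound_of_abs_le {X : Type*} {ω : X → ℝ} (hω : ∀ x, 0 ≤ ω x) {β K c : ℝ} (hβ : 0 < β)
    (hK : 0 ≤ K) (hc : 0 ≤ c) {φ : X → ℝ} (h : ∀ x, |φ x| ≤ K + c * ω x) :
    OscBound ω β (K + c / β) φ := fun x y => by
  have hx := hω x
  have hy := hω y
  have hcancel : c / β * β = c := div_mul_cancel₀ c hβ.ne'
  calc φ x - φ y ≤ (K + c * ω x) + (K + c * ω y) := by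
        linarith [(abs_le.mp (h x)).2, (abs_le.mp (h y)).1]
    _ ≤ (K + c * ω x) + (K + c * ω y) + (K * β * (ω x + ω y) + 2 * (c / β)) :=
        le_add_of_nonneg_right (by positivity)
    _ = (K + c / β) * (2 + β * ω x + β * ω y) := by linear_combination -(ω x + ω y) * hcancel

variable {X A S : Type*} [TopologicalSpace X] [MeasurableSpace X]
  [TopologicalSpace A] [MeasurableSpace A] [MeasurableSpace S] {ρ : Measure S}
  [IsProbabilityMeasure ρ] {s : S → ℝ} {G : X → S → X} {F : X → A → S → ℝ} {ω : X → ℝ}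
  {b₁ b₂ γ : ℝ}

namespace IsControlModel

lemma abs_util_zero_le (hM : IsControlModel ρ s G F ω b₁ b₂) (hγ : γ < 0) (hγ1 : |γ| ≤ 1) (x : X)
    (h : A) : |util ρ G F γ 0 x h| ≤ logLaplace ρ s + b₂ * ω x := by
  have hs := hM.envelope
  have hF : Dominated s (F x h) := hs.dominated_of_abs_le (C := 1) (c := b₂ * ω x)
    (hM.measurable_reward_right x h) fun w => by linarith [hM.growth_reward x h w]
  have hγF := hs.integrable_exp_of (hF.const_mul γ)
  have hγ' : 0 ≤ -γ := by linarith
  rw [abs_of_neg hγ] at hγ1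
  have hγs := hs.integrable_exp_of (hs.dominated.const_mul (-γ))
  have hlower : γ * ∫ w, F x h w ∂ρ ≤ logLaplace ρ fun w => γ * F x h w := by
    rw [← integral_const_mul]
    exact integral_le_logLaplace hγF (hs.integrable_of (hF.const_mul γ))
  have hmean : ∫ w, F x h w ∂ρ ≤ logLaplace ρ s + b₂ * ω x := by
    calc ∫ w, F x h w ∂ρ ≤ ∫ w, (s w + b₂ * ω x) ∂ρ :=
          integral_mono (hs.integrable_of hF)
            (hs.integrable_of (hs.dominated.add (hs.dominated_const _)))
            fun w => (le_abs_self _).trans (hM.growth_reward x h w)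
      _ = ∫ w, s w ∂ρ + b₂ * ω x := by
          rw [integral_add (hs.integrable_of hs.dominated) (integrable_const _)]
          simp
      _ ≤ _ := by
          gcongr
          exact integral_le_logLaplace (hs.integrable_exp_of hs.dominated)
            (hs.integrable_of hs.dominated)
  have hupper : (logLaplace ρ fun w => γ * F x h w) ≤ -γ * (logLaplace ρ s + b₂ * ω x) := by
    calc (logLaplace ρ fun w => γ * F x h w) ≤ logLaplace ρ fun w => -γ * s w + -γ * (b₂ * ω x) :=
          logLaplace_mono hγF (hs.integrable_exp_of
            ((hs.dominated.const_mul _).add (hs.dominated_const _))) fun w => by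
              nlinarith [neg_le_of_abs_le (hM.growth_reward x h w)]
      _ = logLaplace ρ (fun w => -γ * s w) + -γ * (b₂ * ω x) := logLaplace_add_const hγs _
      _ ≤ -γ * logLaplace ρ s + -γ * (b₂ * ω x) := by
          gcongr
          exact logLaplace_const_mul_le hγ' hγ1 hγs (hs.integrable_exp_of hs.dominated)
      _ = _ := by ring
  simp only [util, Pi.zero_apply, add_zero]
  rw [abs_le, ← div_eq_inv_mul, le_div_iff_of_neg hγ, div_le_iff_of_neg hγ]
  constructor
  · linarith
  · nlinarith

lemma logLaplace_envelope_nonneg (hM : IsControlModel ρ s G F ω b₁ b₂) : 0 ≤ logLaplace ρ s :=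
  have hs := hM.envelope
  (integral_nonneg fun w => (hs.pos w).le).trans <|
    integral_le_logLaplace (hs.integrable_exp_of hs.dominated) (hs.integrable_of hs.dominated)

variable [BorelSpace X] [FirstCountableTopology X] [FirstCountableTopology A] [CompactSpace A]
  [Nonempty A] [Nonempty X]

theorem exists_bellman_solution (hM : IsControlModel ρ s G F ω b₁ b₂)
    (hmin : IsLocallyMinorized ρ G ω) :
    ∃ γ₀ < 0, ∀ γ, γ₀ < γ → γ < 0 → ∃ C v lam, GrowsLinearly ω C v ∧
      ∀ x, v x + lam = bellman ρ G F γ v x := by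
  let x₀ := Classical.arbitrary X
  obtain ⟨β, L, hβ, hβ1, hL₀, hL₁, hcon⟩ := hM.exists_bellman_contraction hmin zero_le_one
  have hω := hM.weight_nonneg
  have hω₀ := hω x₀
  have hb₂ := hM.reward_rate_nonneg
  have hK := hM.logLaplace_envelope_nonneg
  have hL : 0 < 1 - L := sub_pos.mpr hL₁
  -- The image of `0` has oscillation at most `(1 - L) * M` uniformly in `γ`, so the iteration stays
  -- in a fixed ball, and `|γ| * C ≤ 1` keeps that ball in the range where the operator contracts.
  set M := (logLaplace ρ s + b₂ / β) / (1 - L) with hMdef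
  have hM₀ : 0 ≤ M := by positivity
  set C := M * (2 + ω x₀)
  have hC₀ : 0 ≤ C := by positivity
  refine ⟨-(1 + C)⁻¹, neg_lt_zero.mpr (by positivity), fun γ hγ₀ hγ => ?_⟩
  have hγC : |γ| * (1 + C) ≤ 1 := by
    rw [abs_of_neg hγ, ← le_div_iff₀ (by positivity), one_div]
    linarith
  have hγ1 : |γ| ≤ 1 := by nlinarith [abs_nonneg γ]
  have hgrow (f : X → ℝ) (hf : f ∈ oscBall ω β M x₀) : GrowsLinearly ω C f :=
    ⟨hf.1, hf.2.2.abs_le_of_eq_zero hM₀ hβ1 hω hf.2.1⟩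
  have hT : IsOscContraction (bellman ρ G F γ) ω β L M x₀ :=
    { continuous := fun f hf => hM.continuous_bellman (hgrow f hf) γ
      contracts := fun f hf g hg => hcon γ hγ hγ1 C (by nlinarith [abs_nonneg γ]) f g (hgrow f hf)
        (hgrow g hg)
      map_zero := by
        rw [hMdef, mul_div_cancel₀ _ hL.ne']
        refine oscBound_of_abs_le hω hβ hK hb₂ fun x => ?_
        obtain ⟨h, hmax⟩ := hM.exists_bellman_eq growsLinearly_zero γ x
        exact hmax ▸ hM.abs_util_zero_le hγ hγ1 x h }
  obtain ⟨v, hv, hfix⟩ := hT.exists_relative_fixedPoint hM.continuous_weight hω hβ.le hM₀ hL₀ hL₁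
  exact ⟨C, v, _, hgrow v hv, hfix⟩

theorem bellman_solution_unique (hM : IsControlModel ρ s G F ω b₁ b₂)
    (hmin : IsLocallyMinorized ρ G ω) (hγ : γ < 0) {C C' lam lam' : ℝ} {v v' : X → ℝ}
    (hv : GrowsLinearly ω C v) (hv' : GrowsLinearly ω C' v')
    (h : ∀ x, v x + lam = bellman ρ G F γ v x) (h' : ∀ x, v' x + lam' = bellman ρ G F γ v' x) :
    lam' = lam ∧ ∃ c, ∀ x, v' x = v x + c := by
  let x₀ := Classical.arbitrary X
  have hω := hM.weight_nonneg
  have hC := hv.nonneg hω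
  have hC' := hv'.nonneg hω
  obtain ⟨β, L, hβ, -, hL₀, hL₁, hcon⟩ :=
    hM.exists_bellman_contraction hmin (D := |γ| * (1 + (C + C'))) (by positivity)
  have hstep := hcon γ hγ (le_mul_of_one_le_right (abs_nonneg γ) (by linarith)) (C + C')
    (mul_le_mul_of_nonneg_left (by linarith) (abs_nonneg γ)) v v' (hv.mono hω (by linarith))
    (hv'.mono hω (by linarith))
  set M := (C + C') + (C + C') / β
  have hosc (n : ℕ) : OscBound ω β (L ^ n * M) (fun x => v x - v' x) := by
    induction n with
    | zero =>
      rw [pow_zero, one_mul]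
      exact oscBound_of_abs_le hω hβ (by positivity) (by positivity) fun x =>
        ((hv.sub hv').abs_le x).trans_eq (by ring)
    | succ n ih =>
      intro x y
      have hxy := hstep _ ih x y
      simp only [← h, ← h'] at hxy
      rw [pow_succ', mul_assoc]
      linarith
  have hlim : Tendsto (fun n : ℕ => L ^ n * M) atTop (nhds 0) := by
    simpa using (tendsto_pow_atTop_nhds_zero_of_lt_one hL₀ hL₁).mul_const M
  have hconst (x : X) : v' x = v x + (v' x₀ - v x₀) := by
    linarith [OscBound.eq_of_tendsto_zero hlim hosc x x₀]
  refine ⟨?_, _, hconst⟩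
  have hshift := hM.bellman_add_const hγ.ne hv (v' x₀ - v x₀) x₀
  rw [← funext hconst, ← h, ← h'] at hshift
  linarith

end IsControlModel

end BellmanEquation

/-! ### Measurable selection -/

section Selection

variable {X A : Type*}

/-- The correspondence of the minimizers of `q` in `Γ x`. -/
def argminOn (Γ : X → Set A) (q : A → ℝ) (x : X) : Set A :=
  {a | a ∈ Γ x ∧ IsMinOn q (Γ x) a}

/-- Successive minimization of `q 0, …, q (n - 1)` over `Γ`. -/
def lexArgmin (Γ : X → Set A) (q : ℕ → A → ℝ) : ℕ → X → Set A
  | 0 => Γ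
  | n + 1 => argminOn (lexArgmin Γ q n) (q n)

lemma eq_of_mem_argminOn {Γ : X → Set A} {q : A → ℝ} {x : X} {a b : A}
    (ha : a ∈ argminOn Γ q x) (hb : b ∈ argminOn Γ q x) : q a = q b :=
  le_antisymm (ha.2 hb.1) (hb.2 ha.1)

variable [TopologicalSpace A]

/-- A correspondence with nonempty closed values that is measurable in the sense that the preimage
of every closed set is measurable. -/
structure IsMeasurableCorrespondence [MeasurableSpace X] (Γ : X → Set A) : Prop where
  isClosed : ∀ x, IsClosed (Γ x)
  nonempty : ∀ x, (Γ x).Nonempty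
  measurable : ∀ K, IsClosed K → MeasurableSet {x | (Γ x ∩ K).Nonempty}

variable [CompactSpace A]

lemma argminOn_inter_nonempty_iff {Γ : X → Set A} {x : X} {K : Set A} {q : A → ℝ}
    (hΓ : IsClosed (Γ x)) (hK : IsClosed K) (hq : Continuous q) :
    (argminOn Γ q x ∩ K).Nonempty ↔ (Γ x ∩ K).Nonempty ∧
      ∀ r : ℚ, (Γ x ∩ {a | q a ≤ r}).Nonempty → (Γ x ∩ (K ∩ {a | q a ≤ r})).Nonempty := by
  constructor
  · rintro ⟨a, ⟨ha, hmin⟩, haK⟩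
    exact ⟨⟨a, ha, haK⟩, fun r ⟨b, hb, hbr⟩ => ⟨a, ha, haK, show q a ≤ r from (hmin hb).trans hbr⟩⟩
  · rintro ⟨hne, hr⟩
    obtain ⟨a, ⟨ha, haK⟩, hmin⟩ := (hΓ.inter hK).isCompact.exists_isMinOn hne hq.continuousOn
    refine ⟨a, ⟨ha, fun b hb => ?_⟩, haK⟩
    by_contra hlt
    obtain ⟨r, hbr, hra⟩ : ∃ r : ℚ, q b < r ∧ r < q a := exists_rat_btwn (lt_of_not_ge hlt)
    obtain ⟨c, hc, hcK, hcr⟩ := hr r ⟨b, hb, hbr.le⟩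
    exact hra.not_ge (le_trans (hmin ⟨hc, hcK⟩) hcr)

variable [MeasurableSpace X]

namespace IsMeasurableCorrespondence

lemma argminOn {Γ : X → Set A} (hΓ : IsMeasurableCorrespondence Γ) {q : A → ℝ}
    (hq : Continuous q) : IsMeasurableCorrespondence (argminOn Γ q) where
  isClosed x := by
    simp only [RSC.argminOn, IsMinOn, IsMinFilter, eventually_principal, Set.ofPred_and,
      Set.ofPred_mem_eq, Set.ofPred_forall]
    exact (hΓ.isClosed x).inter (isClosed_biInter fun b _ => isClosed_le hq continuous_const)
  nonempty x := (hΓ.isClosed x).isCompact.exists_isMinOn (hΓ.nonempty x) hq.continuousOn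
  measurable K hK := by
    have hle (r : ℚ) : IsClosed {a | q a ≤ r} := isClosed_le hq continuous_const
    simp only [argminOn_inter_nonempty_iff (hΓ.isClosed _) hK hq, Set.ofPred_and, Set.ofPred_forall,
      imp_iff_not_or, Set.ofPred_or]
    exact (hΓ.measurable K hK).inter (MeasurableSet.iInter fun r =>
      (hΓ.measurable _ (hle r)).compl.union (hΓ.measurable _ (hK.inter (hle r))))

lemma lexArgmin {Γ : X → Set A} (hΓ : IsMeasurableCorrespondence Γ) {q : ℕ → A → ℝ}
    (hq : ∀ i, Continuous (q i)) (n : ℕ) : IsMeasurableCorrespondence (lexArgmin Γ q n) := by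
  induction n with
  | zero => exact hΓ
  | succ n ih => exact ih.argminOn (hq n)

lemma iInter {Γ : ℕ → X → Set A} (hΓ : ∀ n, IsMeasurableCorrespondence (Γ n))
    (hanti : ∀ n x, Γ (n + 1) x ⊆ Γ n x) : IsMeasurableCorrespondence fun x => ⋂ n, Γ n x := by
  have hne {x : X} {K : Set A} (hK : IsClosed K) :
      ((⋂ n, Γ n x) ∩ K).Nonempty ↔ ∀ n, (Γ n x ∩ K).Nonempty := by
    rw [Set.iInter_inter]
    refine ⟨fun h n => h.mono (Set.iInter_subset _ n), fun h => ?_⟩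
    exact IsCompact.nonempty_iInter_of_sequence_nonempty_isCompact_isClosed _
      (fun n => Set.inter_subset_inter_left K (hanti n x)) h
      (((hΓ 0).isClosed x).inter hK).isCompact fun n => ((hΓ n).isClosed x).inter hK
  refine ⟨fun x => isClosed_iInter fun n => (hΓ n).isClosed x, fun x => ?_, fun K hK => ?_⟩
  · simpa [(hΓ _).nonempty x] using hne (x := x) isClosed_univ
  · simp only [hne hK, Set.ofPred_forall]
    exact MeasurableSet.iInter fun n => (hΓ n).measurable K hK

end IsMeasurableCorrespondence

end Selection

section Argmax

variable {X A : Type*} [MeasurableSpace X] [MetricSpace A] [CompactSpace A]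

/-- Minimizing successively the distances to the points of a dense sequence singles out one point
of each value of the correspondence. -/
theorem exists_measurable_selector [MeasurableSpace A] [BorelSpace A] {Γ : X → Set A}
    (hΓ : IsMeasurableCorrespondence Γ) : ∃ η : X → A, Measurable η ∧ ∀ x, η x ∈ Γ x := by
  rcases isEmpty_or_nonempty A with hA | hA
  · have : IsEmpty X := ⟨fun x => (hΓ.nonempty x).to_type.elim (fun a => hA.false a)⟩
    exact ⟨isEmptyElim, measurable_of_empty _, isEmptyElim⟩
  set q : ℕ → A → ℝ := fun i a => dist a (TopologicalSpace.denseSeq A i)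
  have hsub (n : ℕ) (x : X) : lexArgmin Γ q (n + 1) x ⊆ lexArgmin Γ q n x := fun a ha => ha.1
  have hlex := IsMeasurableCorrespondence.iInter
    (hΓ.lexArgmin (q := q) fun i => continuous_id.dist continuous_const) hsub
  have huniq {x : X} {a b : A} (ha : a ∈ ⋂ n, lexArgmin Γ q n x)
      (hb : b ∈ ⋂ n, lexArgmin Γ q n x) : a = b := by
    have hdist : dist a = dist b := by
      refine (TopologicalSpace.denseRange_denseSeq A).equalizer
        (continuous_const.dist continuous_id) (continuous_const.dist continuous_id)
        (funext fun i => ?_)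
      exact eq_of_mem_argminOn (Set.mem_iInter.mp ha (i + 1)) (Set.mem_iInter.mp hb (i + 1))
    rw [← dist_eq_zero, hdist, dist_self]
  choose η hη using hlex.nonempty
  refine ⟨η, measurable_of_isClosed fun K hK => ?_, fun x => Set.mem_iInter.mp (hη x) 0⟩
  convert hlex.measurable K hK using 1
  ext x
  exact ⟨fun h => ⟨η x, hη x, h⟩, fun ⟨a, ha, haK⟩ =>
    Set.mem_preimage.mpr (huniq (hη x) ha ▸ haK)⟩

variable [TopologicalSpace X] [OpensMeasurableSpace X] [Nonempty A] {u : X → A → ℝ}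

lemma isMeasurableCorrespondence_argmax (hu : Continuous fun p : X × A => u p.1 p.2) :
    IsMeasurableCorrespondence fun x => {a | ∀ b, u x b ≤ u x a} where
  isClosed x := by
    rw [Set.ofPred_forall]
    exact isClosed_iInter fun b =>
      isClosed_le continuous_const (hu.comp (Continuous.prodMk_right x))
  nonempty x := by
    obtain ⟨a, -, ha⟩ := isCompact_univ.exists_isMaxOn Set.univ_nonempty
      (hu.comp (Continuous.prodMk_right x)).continuousOn
    exact ⟨a, fun b => ha (Set.mem_univ b)⟩
  measurable K hK := by
    have hgraph : IsClosed {p : X × A | (∀ b, u p.1 b ≤ u p.1 p.2) ∧ p.2 ∈ K} := by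
      rw [Set.ofPred_and, Set.ofPred_forall]
      exact (isClosed_iInter fun b => isClosed_le
        (hu.comp (continuous_fst.prodMk continuous_const)) hu).inter (hK.preimage continuous_snd)
    convert (isClosedMap_fst_of_compactSpace _ hgraph).measurableSet using 1
    ext x
    simp [Set.Nonempty]

theorem exists_measurable_argmax [MeasurableSpace A] [BorelSpace A]
    (hu : Continuous fun p : X × A => u p.1 p.2) :
    ∃ η : X → A, Measurable η ∧ ∀ x a, u x a ≤ u x (η x) :=
  exists_measurable_selector (isMeasurableCorrespondence_argmax hu)

end Argmax

/-! ### The control model of the factor and portfolio dynamics -/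

section Envelope

lemma lintegral_exp_eq_ofReal_exp_logLaplace {S : Type*} [MeasurableSpace S] {ρ : Measure S}
    [NeZero ρ] {Z : S → ℝ} (hZ : Integrable (fun w => Real.exp (Z w)) ρ) :
    ∫⁻ w, ENNReal.ofReal (Real.exp (Z w)) ∂ρ = ENNReal.ofReal (Real.exp (logLaplace ρ Z)) := by
  rw [logLaplace, Real.exp_log (integral_exp_pos hZ),
    ofReal_integral_eq_lintegral_ofReal hZ (ae_of_all _ fun w => (Real.exp_pos _).le)]

lemma integrable_exp_add {S : Type*} [MeasurableSpace S] {ρ : Measure S} {f g : S → ℝ}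
    (hf : Measurable f) (hg : Measurable g) (hf₂ : Integrable (fun w => Real.exp (2 * f w)) ρ)
    (hg₂ : Integrable (fun w => Real.exp (2 * g w)) ρ) :
    Integrable (fun w => Real.exp (f w + g w)) ρ := by
  refine (hf₂.add hg₂).mono' (hf.add hg).exp.aestronglyMeasurable (ae_of_all _ fun w => ?_)
  rw [Real.norm_eq_abs, Real.abs_exp, Pi.add_apply, Real.exp_add, two_mul, two_mul, Real.exp_add,
    Real.exp_add]
  nlinarith [sq_nonneg (Real.exp (f w) - Real.exp (g w)), sq_nonneg (Real.exp (f w)),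
    sq_nonneg (Real.exp (g w))]

variable {Ω : Type*} [MeasurableSpace Ω] {P : Measure Ω}

lemma lintegral_exp_ne_top_of_entropicUtility_eq {Z : Ω → ℝ} {γ r : ℝ} (hγ : γ ≠ 0)
    (h : entropicUtility P γ Z = (r : EReal)) :
    ∫⁻ o, ENNReal.ofReal (Real.exp (γ * Z o)) ∂P ≠ ⊤ := by
  intro htop
  rw [entropicUtility, if_neg hγ, htop, ENNReal.log_top] at h
  rcases hγ.lt_or_gt with hneg | hpos
  · rw [EReal.coe_mul_top_of_neg (one_div_neg.mpr hneg)] at h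
    exact EReal.bot_ne_coe r h
  · rw [EReal.coe_mul_top_of_pos (one_div_pos.mpr hpos)] at h
    exact EReal.top_ne_coe r h

lemma integrable_exp_of_entropicUtility_eq [IsProbabilityMeasure P] {S : Type*}
    [MeasurableSpace S] {Y : Ω → S} (hY : Measurable Y) {a : S → ℝ} (ha : Measurable a) {θ : ℝ}
    (h : ∃ r : ℝ, entropicUtility P θ (fun o => a (Y o)) = (r : EReal)) :
    Integrable (fun w => Real.exp (θ * a w)) (P.map Y) := by
  have : IsProbabilityMeasure (P.map Y) := Measure.isProbabilityMeasure_map hY.aemeasurable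
  rcases eq_or_ne θ 0 with rfl | hθ
  · simp
  obtain ⟨r, hr⟩ := h
  have hm : Measurable fun w => Real.exp (θ * a w) := (ha.const_mul θ).exp
  refine ⟨hm.aestronglyMeasurable, ?_⟩
  rw [hasFiniteIntegral_iff_ofReal (ae_of_all _ fun w => (Real.exp_pos _).le),
    lintegral_map hm.ennreal_ofReal hY]
  exact (lintegral_exp_ne_top_of_entropicUtility_eq hθ hr).lt_top

end Envelope

section Bridge

variable {Ω : Type*} [MeasurableSpace Ω] {P : Measure Ω} {k m n : ℕ}
  {U : Set (Vec m)} {W : ℕ → Ω → Vec n} {G : Vec k → Vec n → Vec k} {F : Vec k → U → Vec n → ℝ}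
  {ω : Vec k → ℝ} {a₁ a₂ : Vec n → ℝ} {b₁ b₂ γ C : ℝ}

lemma memWeighted_iff (hω : ∀ x, 0 ≤ ω x) {f : Vec k → ℝ} :
    MemWeighted ω f ↔ ∃ C, GrowsLinearly ω C f := by
  have hC (C : ℝ) : C ∈ upperBounds (Set.range fun x => |f x| / (1 + ω x)) ↔
      ∀ x, |f x| ≤ C * (1 + ω x) := by
    simp only [mem_upperBounds, Set.forall_mem_range]
    exact forall_congr' fun x => div_le_iff₀ (by linarith [hω x])
  exact ⟨fun ⟨hf, C, hb⟩ => ⟨C, hf, (hC C).mp hb⟩,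
    fun ⟨C, hf⟩ => ⟨hf.continuous, C, (hC C).mpr hf.abs_le⟩⟩

lemma HasLocalMinorization.isLocallyMinorized (hA5 : HasLocalMinorization P W G ω)
    (hW : Measurable (W 0)) (hA2 : IsFactorMap G) : IsLocallyMinorized (P.map (W 0)) G ω := by
  intro R hR
  obtain ⟨c, hc, ν, hν, h⟩ := hA5 R hR
  refine ⟨c, hc, ν, hν, fun x hx => Measure.le_iff.mpr fun s hs => ?_⟩
  have hG : Measurable (G x) := hA2.measurable.comp (measurable_const.prodMk measurable_id)
  rw [Measure.smul_apply, Measure.map_apply hG hs, Measure.map_apply hW (hG hs)]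
  exact h x hx s hs

variable [IsProbabilityMeasure P]

lemma HasWeightedGrowth.isExpEnvelope (hA4 : HasWeightedGrowth P W G F ω a₁ a₂ b₁ b₂)
    (hW : Measurable (W 0)) : IsExpEnvelope (P.map (W 0)) fun w => 1 + (a₁ w + a₂ w) where
  measurable := measurable_const.add (hA4.a₁_measurable.add hA4.a₂_measurable)
  one_le w := by linarith [hA4.a₁_nonneg w, hA4.a₂_nonneg w]
  integrable_exp θ := by
    have h₁ := integrable_exp_of_entropicUtility_eq hW hA4.a₁_measurable (hA4.a₁_utility (2 * θ))
    have h₂ := integrable_exp_of_entropicUtility_eq hW hA4.a₂_measurable (hA4.a₂_utility (2 * θ))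
    simp only [mul_add, mul_one, Real.exp_add θ]
    refine (integrable_exp_add (hA4.a₁_measurable.const_mul θ) (hA4.a₂_measurable.const_mul θ)
      ?_ ?_).const_mul _ <;> simpa only [← mul_assoc]

lemma HasWeightedGrowth.isControlModel (hA4 : HasWeightedGrowth P W G F ω a₁ a₂ b₁ b₂)
    (hW : Measurable (W 0)) (hA2 : IsFactorMap G) (hA3 : IsLogReturnMap F) :
    IsControlModel (P.map (W 0)) (fun w => 1 + (a₁ w + a₂ w)) G F ω b₁ b₂ where
  measurable_map := hA2.measurable
  measurable_weight := hA4.weight_continuous.measurable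
  weight_nonneg := hA4.weight_nonneg
  envelope := hA4.isExpEnvelope hW
  rate_nonneg := hA4.b₁_pos.le
  rate_lt_one := hA4.b₁_lt_one
  growth_map x w := by linarith [hA4.growth_G x w, hA4.a₂_nonneg w]
  continuous_map := hA2.continuous
  continuous_weight := hA4.weight_continuous
  measurable_reward := hA3.measurable
  continuous_reward := hA3.continuous
  reward_rate_nonneg := hA4.b₂_pos.le
  growth_reward x h w := by linarith [hA4.growth_F x h w, hA4.a₁_nonneg w]

variable {s : Vec n → ℝ} {v : Vec k → ℝ}

lemma bellmanUtility_eq_coe_util (hW : Measurable (W 0))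
    (hM : IsControlModel (P.map (W 0)) s G F ω b₁ b₂) (hγ : γ ≠ 0) (hv : GrowsLinearly ω C v)
    (x : Vec k) (h : U) :
    bellmanUtility P G F W γ v x h = (util (P.map (W 0)) G F γ v x h : EReal) := by
  have : IsProbabilityMeasure (P.map (W 0)) := Measure.isProbabilityMeasure_map hW.aemeasurable
  rw [bellmanUtility, entropicUtility, if_neg hγ, util, EReal.coe_mul, one_div,
    ← lintegral_map (f := fun w => ENNReal.ofReal (Real.exp (γ * (F x h w + v (G x w)))))
      (hM.measurable_exponent hv.continuous γ x h).exp.ennreal_ofReal hW,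
    lintegral_exp_eq_ofReal_exp_logLaplace (hM.integrable_exp_exponent hv γ x h),
    ENNReal.log_ofReal_of_pos (Real.exp_pos _), Real.log_exp]

variable [CompactSpace U] [Nonempty U]

lemma iSup_bellmanUtility_eq_coe_bellman (hW : Measurable (W 0))
    (hM : IsControlModel (P.map (W 0)) s G F ω b₁ b₂) (hγ : γ ≠ 0) (hv : GrowsLinearly ω C v)
    (x : Vec k) :
    ⨆ h : U, bellmanUtility P G F W γ v x h = (bellman (P.map (W 0)) G F γ v x : EReal) := by
  have : IsProbabilityMeasure (P.map (W 0)) := Measure.isProbabilityMeasure_map hW.aemeasurable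
  simp only [bellmanUtility_eq_coe_util hW hM hγ hv]
  refine le_antisymm (iSup_le fun h => EReal.coe_le_coe (hM.util_le_bellman hv γ x h)) ?_
  obtain ⟨h, hmax⟩ := hM.exists_bellman_eq hv γ x
  exact hmax ▸ le_iSup (fun h => (util (P.map (W 0)) G F γ v x h : EReal)) h

lemma isBellmanSolution_iff (hW : Measurable (W 0))
    (hM : IsControlModel (P.map (W 0)) s G F ω b₁ b₂) (hγ : γ ≠ 0) {lam : ℝ} :
    IsBellmanSolution P G F W ω γ v lam ↔ ∃ C, GrowsLinearly ω C v ∧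
      ∀ x, v x + lam = bellman (P.map (W 0)) G F γ v x := by
  rw [IsBellmanSolution, memWeighted_iff hM.weight_nonneg, ← exists_and_right]
  refine exists_congr fun C => and_congr_right fun hv => forall_congr' fun x => ?_
  rw [iSup_bellmanUtility_eq_coe_bellman hW hM hγ hv, EReal.coe_eq_coe_iff]

lemma isBellmanSelector_iff (hW : Measurable (W 0))
    (hM : IsControlModel (P.map (W 0)) s G F ω b₁ b₂) (hγ : γ ≠ 0) (hv : GrowsLinearly ω C v)
    {η : Vec k → U} : IsBellmanSelector P G F W γ v η ↔ Measurable η ∧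
      ∀ x, util (P.map (W 0)) G F γ v x (η x) = bellman (P.map (W 0)) G F γ v x := by
  refine and_congr_right fun _ => forall_congr' fun x => ?_
  rw [iSup_bellmanUtility_eq_coe_bellman hW hM hγ hv, bellmanUtility_eq_coe_util hW hM hγ hv,
    EReal.coe_eq_coe_iff]

lemma exists_isBellmanSelector (hW : Measurable (W 0))
    (hM : IsControlModel (P.map (W 0)) s G F ω b₁ b₂) (hγ : γ ≠ 0) (hv : GrowsLinearly ω C v) :
    ∃ η : Vec k → U, IsBellmanSelector P G F W γ v η := by
  have : IsProbabilityMeasure (P.map (W 0)) := Measure.isProbabilityMeasure_map hW.aemeasurable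
  obtain ⟨η, hη, hmax⟩ := exists_measurable_argmax (hM.continuous_util hv γ)
  exact ⟨η, (isBellmanSelector_iff hW hM hγ hv).mpr
    ⟨hη, fun x => (hM.util_le_bellman hv γ x _).antisymm (ciSup_le (hmax x))⟩⟩

end Bridge

/-! ### Weighted moments of the portfolio value -/

section Strategies

variable {Ω : Type*} {k m n : ℕ} {U : Set (Vec m)} {W : ℕ → Ω → Vec n}
  {G : Vec k → Vec n → Vec k} {F : Vec k → U → Vec n → ℝ} {H : ℕ → Ω → U} {x₀ : Vec k} {V₀ γ : ℝ}

lemma noiseSigma_mono (W : ℕ → Ω → Vec n) : Monotone (noiseSigma W) := fun _ _ h =>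
  iSup_mono fun _ => iSup_mono' fun hr => ⟨hr.trans_le h, le_rfl⟩

lemma measurable_noise (W : ℕ → Ω → Vec n) (t : ℕ) : Measurable[noiseSigma W (t + 1)] (W t) :=
  measurable_iff_comap_le.mpr (le_iSup₂_of_le t t.lt_succ_self le_rfl)

lemma measurable_factor (hG : Measurable fun p : Vec k × Vec n => G p.1 p.2) (W : ℕ → Ω → Vec n)
    (x₀ : Vec k) (t : ℕ) : Measurable[noiseSigma W t] (factor G W x₀ t) := by
  induction t with
  | zero => exact measurable_const
  | succ t ih =>
    exact hG.comp ((ih.mono (noiseSigma_mono W t.le_succ) le_rfl).prodMk (measurable_noise W t))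

lemma measurable_portfolioValue (hG : Measurable fun p : Vec k × Vec n => G p.1 p.2)
    (hF : Measurable fun p : Vec k × U × Vec n => F p.1 p.2.1 p.2.2) (hH : IsAdmissible W H)
    (x₀ : Vec k) (V₀ : ℝ) (t : ℕ) :
    Measurable[noiseSigma W t] (portfolioValue G F W x₀ V₀ H t) := by
  induction t with
  | zero => exact measurable_const
  | succ t ih =>
    have hle := noiseSigma_mono W t.le_succ
    have hlog : Measurable[noiseSigma W (t + 1)] fun o =>
        F (factor G W x₀ t o) (H t o) (W t o) :=
      hF.comp (((measurable_factor hG W x₀ t).mono hle le_rfl).prodMk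
        (((hH t).mono hle le_rfl).prodMk (measurable_noise W t)))
    exact (ih.mono hle le_rfl).mul hlog.exp

lemma isAdmissible_feedback (hG : Measurable fun p : Vec k × Vec n => G p.1 p.2) {η : Vec k → U}
    (hη : Measurable η) (x₀ : Vec k) : IsAdmissible W fun t o => η (factor G W x₀ t o) :=
  fun t => hη.comp (measurable_factor hG W x₀ t)

lemma portfolioValue_pos (hV : 0 < V₀) (t : ℕ) (o : Ω) :
    0 < portfolioValue G F W x₀ V₀ H t o := by
  induction t with
  | zero => exact hV
  | succ t ih => exact mul_pos ih (Real.exp_pos _)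

lemma portfolioValue_rpow_pos (hV : 0 < V₀) (γ : ℝ) (t : ℕ) (o : Ω) :
    0 < portfolioValue G F W x₀ V₀ H t o ^ γ :=
  Real.rpow_pos_of_pos (portfolioValue_pos hV t o) γ

lemma portfolioValue_succ_rpow (hV : 0 < V₀) (γ : ℝ) (t : ℕ) (o : Ω) :
    portfolioValue G F W x₀ V₀ H (t + 1) o ^ γ = portfolioValue G F W x₀ V₀ H t o ^ γ *
      Real.exp (γ * F (factor G W x₀ t o) (H t o) (W t o)) := by
  rw [portfolioValue, Real.mul_rpow (portfolioValue_pos hV t o).le (Real.exp_pos _).le,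
    ← Real.exp_mul, mul_comm γ]

variable [MeasurableSpace Ω] {P : Measure Ω}

lemma noiseSigma_le (hA1 : IsIIDNoise P W) (t : ℕ) : noiseSigma W t ≤ ‹MeasurableSpace Ω› :=
  iSup₂_le fun s _ => (hA1.measurable s).comap_le

lemma indepFun_noise (hA1 : IsIIDNoise P W) {E : Type*} [MeasurableSpace E] {t : ℕ} {Y : Ω → E}
    (hY : Measurable[noiseSigma W t] Y) : IndepFun Y (W t) P := by
  have hpast := indep_iSup_of_disjoint (fun s => (hA1.measurable s).comap_le) hA1.indep.iIndep
    (S := Set.Iio t) (T := {t}) (by simp)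
  exact (IndepFun_iff_Indep Y (W t) P).mpr <| indep_of_indep_of_le_left
    (indep_of_indep_of_le_right hpast (le_iSup₂_of_le t rfl le_rfl)) hY.comap_le

lemma lintegral_comp_noise [IsProbabilityMeasure P] (hA1 : IsIIDNoise P W) {E : Type*}
    [MeasurableSpace E] {t : ℕ} {Y : Ω → E} (hY : Measurable[noiseSigma W t] Y)
    {Φ : E × Vec n → ENNReal} (hΦ : Measurable Φ) :
    ∫⁻ o, Φ (Y o, W t o) ∂P = ∫⁻ o, ∫⁻ w, Φ (Y o, w) ∂(P.map (W 0)) ∂P := by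
  have hY' : Measurable Y := hY.mono (noiseSigma_le hA1 t) le_rfl
  have hWt := hA1.measurable t
  have : IsProbabilityMeasure (P.map (W t)) := Measure.isProbabilityMeasure_map hWt.aemeasurable
  rw [← lintegral_map hΦ (hY'.prodMk hWt),
    (indepFun_iff_map_prod_eq_prod_map_map hY'.aemeasurable hWt.aemeasurable).mp
      (indepFun_noise hA1 hY),
    lintegral_prod _ hΦ.aemeasurable, lintegral_map hΦ.lintegral_prod_right' hY',
    (hA1.identDistrib t).map_eq]

/-- The moment `E[V_t ^ γ * exp (φ (X_t))]` of the portfolio value, weighted by a function `φ` of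
the factor and taken in `[0, ∞]`. -/
noncomputable def valueMoment (P : Measure Ω) (G : Vec k → Vec n → Vec k)
    (F : Vec k → U → Vec n → ℝ) (W : ℕ → Ω → Vec n) (x₀ : Vec k) (V₀ : ℝ) (H : ℕ → Ω → U) (γ : ℝ)
    (φ : Vec k → ℝ) (t : ℕ) : ENNReal :=
  ∫⁻ o, ENNReal.ofReal (portfolioValue G F W x₀ V₀ H t o ^ γ * Real.exp (φ (factor G W x₀ t o))) ∂P

variable {φ ψ : Vec k → ℝ}

lemma valueMoment_zero [IsProbabilityMeasure P] (hV : 0 < V₀) (φ : Vec k → ℝ) :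
    valueMoment P G F W x₀ V₀ H γ φ 0 =
      ENNReal.ofReal (Real.exp (γ * Real.log V₀ + φ x₀)) := by
  simp [valueMoment, portfolioValue, factor, Real.exp_add, Real.rpow_def_of_pos hV, mul_comm γ]

lemma valueMoment_mono (hV : 0 < V₀) {t : ℕ}
    (h : ∀ o, φ (factor G W x₀ t o) ≤ ψ (factor G W x₀ t o)) :
    valueMoment P G F W x₀ V₀ H γ φ t ≤ valueMoment P G F W x₀ V₀ H γ ψ t :=
  lintegral_mono fun o => ENNReal.ofReal_le_ofReal <|
    mul_le_mul_of_nonneg_left (Real.exp_le_exp.mpr (h o)) (portfolioValue_rpow_pos hV γ t o).le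

lemma valueMoment_const_add (c : ℝ) (φ : Vec k → ℝ) (t : ℕ) :
    valueMoment P G F W x₀ V₀ H γ (fun x => c + φ x) t =
      ENNReal.ofReal (Real.exp c) * valueMoment P G F W x₀ V₀ H γ φ t := by
  rw [valueMoment, valueMoment, ← lintegral_const_mul' _ _ ENNReal.ofReal_ne_top]
  refine lintegral_congr fun o => ?_
  rw [Real.exp_add, mul_left_comm, ENNReal.ofReal_mul (Real.exp_pos c).le]

lemma valueMoment_succ [IsProbabilityMeasure P] (hA1 : IsIIDNoise P W)
    (hG : Measurable fun p : Vec k × Vec n => G p.1 p.2)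
    (hF : Measurable fun p : Vec k × U × Vec n => F p.1 p.2.1 p.2.2) (hH : IsAdmissible W H)
    (hV : 0 < V₀) (hφ : Measurable φ) (t : ℕ) :
    valueMoment P G F W x₀ V₀ H γ φ (t + 1) =
      ∫⁻ o, ENNReal.ofReal (portfolioValue G F W x₀ V₀ H t o ^ γ) *
        ∫⁻ w, ENNReal.ofReal (Real.exp (γ * F (factor G W x₀ t o) (H t o) w +
          φ (G (factor G W x₀ t o) w))) ∂(P.map (W 0)) ∂P := by
  have hY : Measurable[noiseSigma W t] fun o =>
      (portfolioValue G F W x₀ V₀ H t o ^ γ, factor G W x₀ t o, H t o) :=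
    ((measurable_portfolioValue hG hF hH x₀ V₀ t).pow_const γ).prodMk
      ((measurable_factor hG W x₀ t).prodMk (hH t))
  have hΨ : Measurable fun p : (Vec k × U) × Vec n =>
      ENNReal.ofReal (Real.exp (γ * F p.1.1 p.1.2 p.2 + φ (G p.1.1 p.2))) :=
    (((hF.comp (measurable_fst.fst.prodMk (measurable_fst.snd.prodMk measurable_snd))).const_mul
      γ).add (hφ.comp (hG.comp (measurable_fst.fst.prodMk measurable_snd)))).exp.ennreal_ofReal
  have hΦ : Measurable fun p : (ℝ × Vec k × U) × Vec n => ENNReal.ofReal p.1.1 *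
      ENNReal.ofReal (Real.exp (γ * F p.1.2.1 p.1.2.2 p.2 + φ (G p.1.2.1 p.2))) :=
    measurable_fst.fst.ennreal_ofReal.mul
      (hΨ.comp (measurable_fst.snd.prodMk measurable_snd))
  calc valueMoment P G F W x₀ V₀ H γ φ (t + 1)
      = ∫⁻ o, ENNReal.ofReal (portfolioValue G F W x₀ V₀ H t o ^ γ) *
          ENNReal.ofReal (Real.exp (γ * F (factor G W x₀ t o) (H t o) (W t o) +
            φ (G (factor G W x₀ t o) (W t o)))) ∂P := lintegral_congr fun o => by
        rw [portfolioValue_succ_rpow hV, mul_assoc, ← Real.exp_add,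
          ENNReal.ofReal_mul (portfolioValue_rpow_pos hV γ t o).le, factor]
    _ = _ := lintegral_comp_noise hA1 hY hΦ
    _ = _ := lintegral_congr fun o => by
        dsimp only
        exact lintegral_const_mul _
          (hΨ.comp (measurable_prodMk_left (x := (factor G W x₀ t o, H t o))))

end Strategies

/-! ### Growth of the weighted moments -/

lemma IsControlModel.lintegral_exp_weight_le {X A S : Type*} [TopologicalSpace X]
    [MeasurableSpace X] [TopologicalSpace A] [MeasurableSpace A] [MeasurableSpace S]
    {ρ : Measure S} [NeZero ρ] {s : S → ℝ} {G : X → S → X} {F : X → A → S → ℝ} {ω : X → ℝ}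
    {b₁ b₂ : ℝ} (hM : IsControlModel ρ s G F ω b₁ b₂) (γ : ℝ) {θ : ℝ} (hθ : 0 ≤ θ) (x : X) (h : A) :
    ∫⁻ w, ENNReal.ofReal (Real.exp (γ * F x h w + θ * ω (G x w))) ∂ρ ≤
      ENNReal.ofReal (Real.exp (logLaplace ρ (fun w => (θ + |γ|) * s w) +
        (θ * b₁ + |γ| * b₂) * ω x)) := by
  have hs := hM.envelope.dominated.const_mul (θ + |γ|)
  have hpt (w : S) : γ * F x h w + θ * ω (G x w) ≤
      (θ + |γ|) * s w + (θ * b₁ + |γ| * b₂) * ω x := by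
    have hF : γ * F x h w ≤ |γ| * (s w + b₂ * ω x) :=
      (le_abs_self _).trans <| (abs_mul γ _).trans_le <|
        mul_le_mul_of_nonneg_left (hM.growth_reward x h w) (abs_nonneg γ)
    linarith [mul_le_mul_of_nonneg_left (hM.growth_map x w) hθ]
  rw [← logLaplace_add_const (hM.envelope.integrable_exp_of hs),
    ← lintegral_exp_eq_ofReal_exp_logLaplace
      (hM.envelope.integrable_exp_of (hs.add (hM.envelope.dominated_const _)))]
  exact lintegral_mono fun w => ENNReal.ofReal_le_ofReal (Real.exp_le_exp.mpr (hpt w))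

section AffineRecursion

variable {D : ℝ → ℕ → ENNReal} {L z : ℝ → ℝ} {a b : ℝ}

lemma exists_le_exp_of_affine_step (hzero : ∀ θ, D θ 0 ≤ ENNReal.ofReal (Real.exp (z θ)))
    (hstep : ∀ θ, 0 ≤ θ → ∀ t,
      D θ (t + 1) ≤ ENNReal.ofReal (Real.exp (L θ)) * D (θ * b + a) t)
    {c : ℝ} (hc : 0 ≤ c) {θ : ℝ} (hθ : 0 ≤ θ)
    (h : ∃ κ, ∀ t : ℕ, D (θ * b + a) t ≤ ENNReal.ofReal (Real.exp (κ + c * t))) :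
    ∃ κ, ∀ t : ℕ, D θ t ≤ ENNReal.ofReal (Real.exp (κ + c * t)) := by
  obtain ⟨κ, hκ⟩ := h
  refine ⟨max (L θ + κ) (z θ), fun t => ?_⟩
  cases t with
  | zero => exact (hzero θ).trans (ENNReal.ofReal_le_ofReal (Real.exp_le_exp.mpr (by simp)))
  | succ t =>
    refine (hstep θ hθ t).trans ((mul_le_mul_right (hκ t) _).trans ?_)
    rw [← ENNReal.ofReal_mul (Real.exp_pos _).le, ← Real.exp_add]
    refine ENNReal.ofReal_le_ofReal (Real.exp_le_exp.mpr ?_)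
    push_cast
    linarith [le_max_left (L θ + κ) (z θ)]

lemma le_exp_of_affine_le_self (hmono : ∀ t, Monotone fun θ => D θ t)
    (hzero : ∀ θ, D θ 0 ≤ ENNReal.ofReal (Real.exp (z θ)))
    (hstep : ∀ θ, 0 ≤ θ → ∀ t,
      D θ (t + 1) ≤ ENNReal.ofReal (Real.exp (L θ)) * D (θ * b + a) t)
    {θ : ℝ} (hθ : 0 ≤ θ) (hle : θ * b + a ≤ θ) (t : ℕ) :
    D θ t ≤ ENNReal.ofReal (Real.exp (z θ + L θ * t)) := by
  induction t with
  | zero => simpa using hzero θ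
  | succ t ih =>
    refine (hstep θ hθ t).trans ((mul_le_mul_right ((hmono t hle).trans ih) _).trans_eq ?_)
    rw [← ENNReal.ofReal_mul (Real.exp_pos _).le, ← Real.exp_add]
    push_cast
    ring_nf

lemma exists_le_exp_of_affine_recursion (ha : 0 ≤ a) (hb₀ : 0 ≤ b) (hb₁ : b < 1)
    (hmono : ∀ t, Monotone fun θ => D θ t)
    (hzero : ∀ θ, D θ 0 ≤ ENNReal.ofReal (Real.exp (z θ)))
    (hstep : ∀ θ, 0 ≤ θ → ∀ t,
      D θ (t + 1) ≤ ENNReal.ofReal (Real.exp (L θ)) * D (θ * b + a) t) :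
    ∃ c, ∀ θ, 0 ≤ θ → ∃ κ, ∀ t : ℕ, D θ t ≤ ENNReal.ofReal (Real.exp (κ + c * t)) := by
  have hb : 0 < 1 - b := sub_pos.mpr hb₁
  set θs := a / (1 - b) + 1 with hθs
  have hθs₀ : 0 ≤ θs := by positivity
  have hθs_step : θs * b + a = θs - (1 - b) := by rw [hθs]; field_simp; ring
  -- `θ ↦ θ b + a` brings every `θ` below `θs` in finitely many steps, and these only affect `κ`.
  have hreach (N : ℕ) : ∀ θ, 0 ≤ θ → θ ≤ θs + N * (1 - b) →
      ∃ κ, ∀ t : ℕ, D θ t ≤ ENNReal.ofReal (Real.exp (κ + max 0 (L θs) * t)) := by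
    induction N with
    | zero =>
      intro θ _ hle
      refine ⟨z θs, fun t => (hmono t (by simpa using hle)).trans <|
        (le_exp_of_affine_le_self hmono hzero hstep hθs₀ (by linarith) t).trans ?_⟩
      gcongr
      exact le_max_right _ _
    | succ N ih =>
      intro θ hθ hle
      refine exists_le_exp_of_affine_step hzero hstep (le_max_left _ _) hθ
        (ih _ (by positivity) ?_)
      push_cast at hle
      nlinarith [mul_le_mul_of_nonneg_right hle hb₀, mul_nonneg (Nat.cast_nonneg (α := ℝ) N)
        (mul_nonneg hb.le hb.le), mul_nonneg hb.le hb.le]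
  refine ⟨max 0 (L θs), fun θ hθ => ?_⟩
  obtain ⟨N, hN⟩ := exists_nat_ge ((θ - θs) / (1 - b))
  rw [div_le_iff₀ hb] at hN
  exact hreach N θ hθ (by linarith)

end AffineRecursion

section Growth

variable {Ω : Type*} [MeasurableSpace Ω] {P : Measure Ω} [IsProbabilityMeasure P] {k m n : ℕ}
  {U : Set (Vec m)} {W : ℕ → Ω → Vec n} {G : Vec k → Vec n → Vec k} {F : Vec k → U → Vec n → ℝ}
  {H : ℕ → Ω → U} {x₀ : Vec k} {V₀ γ lam b₁ b₂ C : ℝ} {s : Vec n → ℝ} {ω v : Vec k → ℝ}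

lemma valueMoment_weight_succ_le (hA1 : IsIIDNoise P W)
    (hM : IsControlModel (P.map (W 0)) s G F ω b₁ b₂) (hH : IsAdmissible W H) (hV : 0 < V₀)
    {θ : ℝ} (hθ : 0 ≤ θ) (t : ℕ) :
    valueMoment P G F W x₀ V₀ H γ (fun x => θ * ω x) (t + 1) ≤
      ENNReal.ofReal (Real.exp (logLaplace (P.map (W 0)) fun w => (θ + |γ|) * s w)) *
        valueMoment P G F W x₀ V₀ H γ (fun x => (θ * b₁ + |γ| * b₂) * ω x) t := by
  have : IsProbabilityMeasure (P.map (W 0)) :=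
    Measure.isProbabilityMeasure_map (hA1.measurable 0).aemeasurable
  rw [valueMoment_succ hA1 hM.measurable_map hM.measurable_reward hH hV
    (hM.measurable_weight.const_mul θ), ← valueMoment_const_add]
  refine lintegral_mono fun o => ?_
  rw [ENNReal.ofReal_mul (portfolioValue_rpow_pos hV γ t o).le]
  exact mul_le_mul_right (hM.lintegral_exp_weight_le γ hθ _ _) _

theorem exists_valueMoment_weight_le (hA1 : IsIIDNoise P W)
    (hM : IsControlModel (P.map (W 0)) s G F ω b₁ b₂) (hH : IsAdmissible W H) (hV : 0 < V₀)
    (x₀ : Vec k) (γ : ℝ) :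
    ∃ c, ∀ θ, 0 ≤ θ → ∃ κ, ∀ t : ℕ, valueMoment P G F W x₀ V₀ H γ (fun x => θ * ω x) t ≤
      ENNReal.ofReal (Real.exp (κ + c * t)) :=
  exists_le_exp_of_affine_recursion (mul_nonneg (abs_nonneg γ) hM.reward_rate_nonneg)
    hM.rate_nonneg hM.rate_lt_one
    (fun _ _ _ h => valueMoment_mono hV fun _ =>
      mul_le_mul_of_nonneg_right h (hM.weight_nonneg _))
    (fun _ => (valueMoment_zero hV _).le)
    (fun _ hθ t => valueMoment_weight_succ_le hA1 hM hH hV hθ t)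

lemma valueMoment_succ_eq_util (hA1 : IsIIDNoise P W)
    (hM : IsControlModel (P.map (W 0)) s G F ω b₁ b₂) (hH : IsAdmissible W H) (hV : 0 < V₀)
    (hγ : γ ≠ 0) (hv : GrowsLinearly ω C v) (t : ℕ) :
    valueMoment P G F W x₀ V₀ H γ (fun x => γ * v x) (t + 1) =
      ∫⁻ o, ENNReal.ofReal (portfolioValue G F W x₀ V₀ H t o ^ γ * Real.exp
        (γ * util (P.map (W 0)) G F γ v (factor G W x₀ t o) (H t o))) ∂P := by
  have : IsProbabilityMeasure (P.map (W 0)) :=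
    Measure.isProbabilityMeasure_map (hA1.measurable 0).aemeasurable
  rw [valueMoment_succ hA1 hM.measurable_map hM.measurable_reward hH hV
    (hv.continuous.measurable.const_mul γ)]
  refine lintegral_congr fun o => ?_
  simp only [← mul_add]
  rw [lintegral_exp_eq_ofReal_exp_logLaplace (hM.integrable_exp_exponent hv γ _ _), util,
    mul_inv_cancel_left₀ hγ, ENNReal.ofReal_mul (portfolioValue_rpow_pos hV γ t o).le]

lemma le_valueMoment_of_util_le (hA1 : IsIIDNoise P W)
    (hM : IsControlModel (P.map (W 0)) s G F ω b₁ b₂) (hH : IsAdmissible W H) (hV : 0 < V₀)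
    (hγ : γ < 0) (hv : GrowsLinearly ω C v)
    (hu : ∀ t o, util (P.map (W 0)) G F γ v (factor G W x₀ t o) (H t o) ≤
      v (factor G W x₀ t o) + lam) (t : ℕ) :
    ENNReal.ofReal (Real.exp (γ * Real.log V₀ + γ * v x₀ + γ * lam * t)) ≤
      valueMoment P G F W x₀ V₀ H γ (fun x => γ * v x) t := by
  induction t with
  | zero => simp [valueMoment_zero hV]
  | succ t ih =>
    calc ENNReal.ofReal (Real.exp (γ * Real.log V₀ + γ * v x₀ + γ * lam * (t + 1 : ℕ)))
        = ENNReal.ofReal (Real.exp (γ * lam)) *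
            ENNReal.ofReal (Real.exp (γ * Real.log V₀ + γ * v x₀ + γ * lam * t)) := by
          rw [← ENNReal.ofReal_mul (Real.exp_pos _).le, ← Real.exp_add]
          push_cast
          ring_nf
      _ ≤ valueMoment P G F W x₀ V₀ H γ (fun x => γ * lam + γ * v x) t :=
          (mul_le_mul_right ih _).trans_eq (valueMoment_const_add _ _ t).symm
      _ ≤ _ := by
          rw [valueMoment_succ_eq_util hA1 hM hH hV hγ.ne hv]
          refine lintegral_mono fun o => ENNReal.ofReal_le_ofReal <| mul_le_mul_of_nonneg_left
            (Real.exp_le_exp.mpr ?_) (portfolioValue_rpow_pos hV γ t o).le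
          linarith [mul_le_mul_of_nonpos_left (hu t o) hγ.le]

lemma valueMoment_eq_of_util_eq (hA1 : IsIIDNoise P W)
    (hM : IsControlModel (P.map (W 0)) s G F ω b₁ b₂) (hH : IsAdmissible W H) (hV : 0 < V₀)
    (hγ : γ ≠ 0) (hv : GrowsLinearly ω C v)
    (hu : ∀ t o, util (P.map (W 0)) G F γ v (factor G W x₀ t o) (H t o) =
      v (factor G W x₀ t o) + lam) (t : ℕ) :
    valueMoment P G F W x₀ V₀ H γ (fun x => γ * v x) t =
      ENNReal.ofReal (Real.exp (γ * Real.log V₀ + γ * v x₀ + γ * lam * t)) := by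
  induction t with
  | zero => simp [valueMoment_zero hV]
  | succ t ih =>
    calc valueMoment P G F W x₀ V₀ H γ (fun x => γ * v x) (t + 1)
        = valueMoment P G F W x₀ V₀ H γ (fun x => γ * lam + γ * v x) t := by
          rw [valueMoment_succ_eq_util hA1 hM hH hV hγ hv]
          exact lintegral_congr fun o => by rw [hu, mul_add, add_comm]
      _ = _ := by
          rw [valueMoment_const_add, ih, ← ENNReal.ofReal_mul (Real.exp_pos _).le, ← Real.exp_add]
          push_cast
          ring_nf

end Growth

/-! ### Verification -/

section Limits

variable {y : ℕ → ℝ} {lam κ : ℝ}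

lemma tendsto_one_div_mul_of_abs_sub_le (h : ∀ t : ℕ, |y t - lam * t| ≤ κ) :
    Tendsto (fun t : ℕ => ((1 / (t : ℝ) * y t : ℝ) : EReal)) atTop (nhds lam) := by
  refine (continuous_coe_real_ereal.tendsto lam).comp (tendsto_iff_dist_tendsto_zero.mpr ?_)
  refine squeeze_zero' (Eventually.of_forall fun t => dist_nonneg) ?_
    (tendsto_const_div_atTop_nhds_zero_nat κ)
  filter_upwards [eventually_gt_atTop 0] with t ht
  have ht' : (0 : ℝ) < t := Nat.cast_pos.mpr ht
  have hdist : 1 / (t : ℝ) * y t - lam = (y t - lam * t) / t := by field_simp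
  rw [Real.dist_eq, hdist, abs_div, abs_of_pos ht']
  exact div_le_div_of_nonneg_right (h t) ht'.le

lemma liminf_one_div_mul_le (h : ∀ t : ℕ, y t ≤ lam * t + κ) :
    liminf (fun t : ℕ => ((1 / (t : ℝ) * y t : ℝ) : EReal)) atTop ≤ lam := by
  have hlim : Tendsto (fun t : ℕ => ((1 / (t : ℝ) * (lam * t + κ) : ℝ) : EReal)) atTop
      (nhds lam) := tendsto_one_div_mul_of_abs_sub_le fun t =>
        (congrArg abs (add_sub_cancel_left _ _)).le
  exact (liminf_le_liminf (.of_forall fun t => EReal.coe_le_coe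
    (mul_le_mul_of_nonneg_left (h t) (by positivity)))).trans_eq hlim.liminf_eq

lemma liminf_log_growth_le {γ j c : ℝ} (hγ : γ < 0) {l : ℕ → ℝ}
    (h : ∀ p : ℝ, 0 < p → p < 1 → ∃ κ : ℝ, ∀ t : ℕ,
      j + γ * lam * t ≤ p * l t + (1 - p) * (κ + c * t)) :
    liminf (fun t : ℕ => ((1 / (t : ℝ) * (1 / γ * l t) : ℝ) : EReal)) atTop ≤ lam := by
  have hbound (p : ℝ) (hp₀ : 0 < p) (hp₁ : p < 1) :
      liminf (fun t : ℕ => ((1 / (t : ℝ) * (1 / γ * l t) : ℝ) : EReal)) atTop ≤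
        ((lam - (1 - p) * c / γ) / p : ℝ) := by
    obtain ⟨κ, hκ⟩ := h p hp₀ hp₁
    refine liminf_one_div_mul_le (κ := (j - (1 - p) * κ) / (γ * p)) fun t => ?_
    have hrw : (lam - (1 - p) * c / γ) / p * t + (j - (1 - p) * κ) / (γ * p) - 1 / γ * l t =
        (j + γ * lam * t - (p * l t + (1 - p) * (κ + c * t))) / (γ * p) := by
      field_simp [hγ.ne]
      ring
    have := div_nonneg_of_nonpos (sub_nonpos.mpr (hκ t)) (mul_neg_of_neg_of_pos hγ hp₀).le
    linarith
  have hlim : Tendsto (fun p : ℝ => (lam - (1 - p) * c / γ) / p) (nhdsWithin 1 (Set.Iio 1))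
      (nhds lam) := by
    have : ContinuousAt (fun p : ℝ => (lam - (1 - p) * c / γ) / p) 1 :=
      ContinuousAt.div (by fun_prop) continuousAt_id one_ne_zero
    simpa using this.continuousWithinAt (s := Set.Iio 1) |>.tendsto
  refine ge_of_tendsto ((continuous_coe_real_ereal.tendsto lam).comp hlim) ?_
  filter_upwards [self_mem_nhdsWithin, nhdsWithin_le_nhds (lt_mem_nhds zero_lt_one)] with p hp₁ hp₀
  exact hbound p hp₀ hp₁

end Limits

section Verification

variable {Ω : Type*} [MeasurableSpace Ω] {P : Measure Ω} {k m n : ℕ}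
  {U : Set (Vec m)} {W : ℕ → Ω → Vec n} {G : Vec k → Vec n → Vec k} {F : Vec k → U → Vec n → ℝ}
  {H : ℕ → Ω → U} {x₀ : Vec k} {V₀ γ lam b₁ b₂ C : ℝ} {s : Vec n → ℝ} {ω v : Vec k → ℝ}

lemma riskSensitiveCriterion_eq_liminf {l : ℕ → ℝ}
    (hl : ∀ t, valueMoment P G F W x₀ V₀ H γ 0 t = ENNReal.ofReal (Real.exp (l t))) :
    riskSensitiveCriterion P γ (portfolioValue G F W x₀ V₀ H) =
      liminf (fun t : ℕ => ((1 / (t : ℝ) * (1 / γ * l t) : ℝ) : EReal)) atTop := by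
  refine congrArg (liminf · atTop) (funext fun t => ?_)
  have := hl t
  simp only [valueMoment, Pi.zero_apply, Real.exp_zero, mul_one] at this
  rw [this, ENNReal.log_ofReal_of_pos (Real.exp_pos _), Real.log_exp, EReal.coe_mul, EReal.coe_mul]

lemma exists_valueMoment_zero_eq_exp [IsProbabilityMeasure P] (hA1 : IsIIDNoise P W)
    (hM : IsControlModel (P.map (W 0)) s G F ω b₁ b₂) (hH : IsAdmissible W H) (hV : 0 < V₀)
    (x₀ : Vec k) (γ : ℝ) :
    ∃ l : ℕ → ℝ, ∀ t, valueMoment P G F W x₀ V₀ H γ 0 t = ENNReal.ofReal (Real.exp (l t)) := by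
  obtain ⟨c, hc⟩ := exists_valueMoment_weight_le hA1 hM hH hV x₀ γ
  obtain ⟨κ, hκ⟩ := hc 0 le_rfl
  simp only [zero_mul] at hκ
  refine ⟨fun t => Real.log (valueMoment P G F W x₀ V₀ H γ 0 t).toReal, fun t => ?_⟩
  have hfin : valueMoment P G F W x₀ V₀ H γ 0 t ≠ ⊤ :=
    ((hκ t).trans_lt ENNReal.ofReal_lt_top).ne
  have hne : valueMoment P G F W x₀ V₀ H γ 0 t ≠ 0 := by
    have hm : Measurable fun o => ENNReal.ofReal (portfolioValue G F W x₀ V₀ H t o ^ γ) :=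
      (((measurable_portfolioValue hM.measurable_map hM.measurable_reward hH x₀ V₀ t).mono
        (noiseSigma_le hA1 t) le_rfl).pow_const γ).ennreal_ofReal
    simp only [valueMoment, Pi.zero_apply, Real.exp_zero, mul_one]
    rw [Ne, lintegral_eq_zero_iff hm]
    intro hzero
    obtain ⟨o, ho⟩ := hzero.exists
    exact (ENNReal.ofReal_pos.mpr (portfolioValue_rpow_pos hV γ t o)).ne' ho
  rw [Real.exp_log (ENNReal.toReal_pos hne hfin), ENNReal.ofReal_toReal hfin]

lemma valueMoment_le_rpow_mul_rpow (hA1 : IsIIDNoise P W)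
    (hG : Measurable fun p : Vec k × Vec n => G p.1 p.2)
    (hF : Measurable fun p : Vec k × U × Vec n => F p.1 p.2.1 p.2.2) (hH : IsAdmissible W H)
    (hV : 0 < V₀) {φ ψ : Vec k → ℝ} (hφ : Measurable φ) (hψ : Measurable ψ) {p q : ℝ} (hp : 0 ≤ p)
    (hq : 0 ≤ q) (hpq : p + q = 1) (t : ℕ) :
    valueMoment P G F W x₀ V₀ H γ (fun x => p * φ x + q * ψ x) t ≤
      valueMoment P G F W x₀ V₀ H γ φ t ^ p * valueMoment P G F W x₀ V₀ H γ ψ t ^ q := by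
  have hle := noiseSigma_le hA1 t
  have hVm := (measurable_portfolioValue hG hF hH x₀ V₀ t).mono hle le_rfl
  have hXm := (measurable_factor hG W x₀ t).mono hle le_rfl
  have hm {f : Vec k → ℝ} (hf : Measurable f) : AEMeasurable (fun o => ENNReal.ofReal
      (portfolioValue G F W x₀ V₀ H t o ^ γ * Real.exp (f (factor G W x₀ t o)))) P :=
    ((hVm.pow_const γ).mul (hf.comp hXm).exp).ennreal_ofReal.aemeasurable
  refine (lintegral_congr fun o => ?_).trans_le
    (ENNReal.lintegral_mul_norm_pow_le (hm hφ) (hm hψ) hp hq hpq)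
  have hpos := portfolioValue_rpow_pos (G := G) (F := F) (W := W) (H := H) (x₀ := x₀) hV γ t o
  rw [ENNReal.ofReal_rpow_of_pos (by positivity), ENNReal.ofReal_rpow_of_pos (by positivity),
    ← ENNReal.ofReal_mul (by positivity), Real.mul_rpow hpos.le (Real.exp_pos _).le,
    Real.mul_rpow hpos.le (Real.exp_pos _).le, mul_mul_mul_comm, ← Real.rpow_add hpos, hpq,
    Real.rpow_one, ← Real.exp_mul, ← Real.exp_mul, ← Real.exp_add, mul_comm (φ _) p,
    mul_comm (ψ _) q]

variable [IsProbabilityMeasure P]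

lemma exists_valueMoment_growsLinearly_le (hA1 : IsIIDNoise P W)
    (hM : IsControlModel (P.map (W 0)) s G F ω b₁ b₂) (hH : IsAdmissible W H) (hV : 0 < V₀)
    (hv : GrowsLinearly ω C v) (x₀ : Vec k) (γ : ℝ) :
    ∃ c, ∀ r, ∃ κ, ∀ t : ℕ, valueMoment P G F W x₀ V₀ H γ (fun x => r * v x) t ≤
      ENNReal.ofReal (Real.exp (κ + c * t)) := by
  obtain ⟨c, hc⟩ := exists_valueMoment_weight_le hA1 hM hH hV x₀ γ
  refine ⟨c, fun r => ?_⟩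
  have hθ : 0 ≤ |r| * C := mul_nonneg (abs_nonneg r) (hv.nonneg hM.weight_nonneg)
  obtain ⟨κ, hκ⟩ := hc _ hθ
  refine ⟨|r| * C + κ, fun t => ?_⟩
  calc valueMoment P G F W x₀ V₀ H γ (fun x => r * v x) t
      ≤ valueMoment P G F W x₀ V₀ H γ (fun x => |r| * C + |r| * C * ω x) t :=
        valueMoment_mono hV fun o => (le_abs_self _).trans <| (abs_mul r _).trans_le <|
          (mul_le_mul_of_nonneg_left (hv.abs_le _) (abs_nonneg r)).trans_eq (by ring)
    _ ≤ ENNReal.ofReal (Real.exp (|r| * C)) * ENNReal.ofReal (Real.exp (κ + c * t)) :=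
        (valueMoment_const_add _ _ t).trans_le (mul_le_mul_right (hκ t) _)
    _ = _ := by rw [← ENNReal.ofReal_mul (Real.exp_pos _).le, ← Real.exp_add, add_assoc]

theorem riskSensitiveCriterion_le (hA1 : IsIIDNoise P W)
    (hM : IsControlModel (P.map (W 0)) s G F ω b₁ b₂) (hH : IsAdmissible W H) (hV : 0 < V₀)
    (hγ : γ < 0) (hv : GrowsLinearly ω C v)
    (hu : ∀ t o, util (P.map (W 0)) G F γ v (factor G W x₀ t o) (H t o) ≤
      v (factor G W x₀ t o) + lam) :
    riskSensitiveCriterion P γ (portfolioValue G F W x₀ V₀ H) ≤ (lam : EReal) := by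
  obtain ⟨l, hl⟩ := exists_valueMoment_zero_eq_exp hA1 hM hH hV x₀ γ
  obtain ⟨c, hc⟩ := exists_valueMoment_growsLinearly_le hA1 hM hH hV hv x₀ γ
  rw [riskSensitiveCriterion_eq_liminf hl]
  refine liminf_log_growth_le (j := γ * Real.log V₀ + γ * v x₀) (c := c) hγ fun p hp₀ hp₁ => ?_
  have hq : 0 < 1 - p := sub_pos.mpr hp₁
  obtain ⟨κ, hκ⟩ := hc (γ / (1 - p))
  refine ⟨κ, fun t => ?_⟩
  have hsplit : (fun x => γ * v x) = fun x =>
      p * (0 : Vec k → ℝ) x + (1 - p) * (γ / (1 - p) * v x) := by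
    funext x
    rw [Pi.zero_apply, mul_zero, zero_add, ← mul_assoc, mul_div_cancel₀ _ hq.ne']
  have hmoment := calc
    ENNReal.ofReal (Real.exp (γ * Real.log V₀ + γ * v x₀ + γ * lam * t))
      ≤ valueMoment P G F W x₀ V₀ H γ (fun x => γ * v x) t :=
        le_valueMoment_of_util_le hA1 hM hH hV hγ hv hu t
    _ ≤ valueMoment P G F W x₀ V₀ H γ 0 t ^ p *
          valueMoment P G F W x₀ V₀ H γ (fun x => γ / (1 - p) * v x) t ^ (1 - p) :=
        hsplit ▸ valueMoment_le_rpow_mul_rpow hA1 hM.measurable_map hM.measurable_reward hH hV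
          measurable_const (hv.continuous.measurable.const_mul _) hp₀.le hq.le
          (add_sub_cancel p 1) t
    _ ≤ ENNReal.ofReal (Real.exp (l t)) ^ p * ENNReal.ofReal (Real.exp (κ + c * t)) ^ (1 - p) := by
        gcongr
        exacts [(hl t).le, hκ t]
    _ = ENNReal.ofReal (Real.exp (p * l t + (1 - p) * (κ + c * t))) := by
        rw [ENNReal.ofReal_rpow_of_pos (Real.exp_pos _), ENNReal.ofReal_rpow_of_pos
          (Real.exp_pos _), ← ENNReal.ofReal_mul (by positivity), ← Real.exp_mul, ← Real.exp_mul,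
          ← Real.exp_add, mul_comm p, mul_comm (1 - p)]
  exact Real.exp_le_exp.mp ((ENNReal.ofReal_le_ofReal_iff (Real.exp_pos _).le).mp hmoment)

theorem riskSensitiveCriterion_eq (hA1 : IsIIDNoise P W)
    (hM : IsControlModel (P.map (W 0)) s G F ω b₁ b₂) (hH : IsAdmissible W H) (hV : 0 < V₀)
    (hγ : γ ≠ 0) (hv : GrowsLinearly ω C v) {B : ℝ} (hB : ∀ t o, ω (factor G W x₀ t o) ≤ B)
    (hu : ∀ t o, util (P.map (W 0)) G F γ v (factor G W x₀ t o) (H t o) =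
      v (factor G W x₀ t o) + lam) :
    riskSensitiveCriterion P γ (portfolioValue G F W x₀ V₀ H) = (lam : EReal) := by
  obtain ⟨l, hl⟩ := exists_valueMoment_zero_eq_exp hA1 hM hH hV x₀ γ
  rw [riskSensitiveCriterion_eq_liminf hl]
  set κ := |γ| * (C * (1 + B))
  set j := γ * Real.log V₀ + γ * v x₀
  have hvκ (t : ℕ) (o : Ω) : |γ * v (factor G W x₀ t o)| ≤ κ := by
    have hC := hv.nonneg hM.weight_nonneg
    rw [abs_mul]
    refine mul_le_mul_of_nonneg_left ((hv.abs_le _).trans ?_) (abs_nonneg γ)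
    gcongr
    exact hB t o
  have hconst (c : ℝ) (t : ℕ) : valueMoment P G F W x₀ V₀ H γ (fun x => c + (0 : Vec k → ℝ) x) t =
      ENNReal.ofReal (Real.exp (c + l t)) := by
    rw [valueMoment_const_add, hl, ← ENNReal.ofReal_mul (Real.exp_pos _).le, ← Real.exp_add]
  have hmoment := valueMoment_eq_of_util_eq hA1 hM hH hV hγ hv hu
  have hexp {a b : ℝ} (h : ENNReal.ofReal (Real.exp a) ≤ ENNReal.ofReal (Real.exp b)) : a ≤ b :=
    Real.exp_le_exp.mp ((ENNReal.ofReal_le_ofReal_iff (Real.exp_pos _).le).mp h)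
  have hupper (t : ℕ) : j + γ * lam * t ≤ κ + l t := hexp <| by
    rw [← hmoment, ← hconst]
    exact valueMoment_mono hV fun o => by simpa using (abs_le.mp (hvκ t o)).2
  have hlower (t : ℕ) : -κ + l t ≤ j + γ * lam * t := hexp <| by
    rw [← hmoment, ← hconst]
    exact valueMoment_mono hV fun o => by simpa using (abs_le.mp (hvκ t o)).1
  refine (tendsto_one_div_mul_of_abs_sub_le (κ := (κ + |j|) / |γ|) fun t => ?_).liminf_eq
  have hdiv : 1 / γ * l t - lam * t = (l t - γ * lam * t) / γ := by field_simp
  rw [hdiv, abs_div]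
  refine div_le_div_of_nonneg_right (abs_le.mpr ⟨?_, ?_⟩) (abs_nonneg γ)
  · linarith [hupper t, neg_abs_le j]
  · linarith [hlower t, le_abs_self j]

end Verification

section OptimalStrategies

variable {Ω : Type*} [MeasurableSpace Ω] {P : Measure Ω} {k m n : ℕ}
  {U : Set (Vec m)} {W : ℕ → Ω → Vec n} {G : Vec k → Vec n → Vec k} {F : Vec k → U → Vec n → ℝ}
  {V₀ γ lam b₁ b₂ : ℝ} {s : Vec n → ℝ} {ω v : Vec k → ℝ}

lemma HasWeightedGrowth.exists_weight_factor_le {a₁ a₂ : Vec n → ℝ}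
    (hA4 : HasWeightedGrowth P W G F ω a₁ a₂ b₁ b₂) (ha : BddAbove (Set.range a₁)) (x₀ : Vec k) :
    ∃ B, ∀ t o, ω (factor G W x₀ t o) ≤ B := by
  obtain ⟨a, ha⟩ := ha
  have ha' (w : Vec n) : a₁ w ≤ a := ha ⟨w, rfl⟩
  have hb : 0 < 1 - b₁ := sub_pos.mpr hA4.b₁_lt_one
  refine ⟨max (ω x₀) (a / (1 - b₁)), fun t o => ?_⟩
  induction t with
  | zero => exact le_max_left _ _
  | succ t ih =>
    set B := max (ω x₀) (a / (1 - b₁))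
    have hB : a ≤ B * (1 - b₁) := (div_le_iff₀ hb).mp (le_max_right _ _)
    calc ω (G (factor G W x₀ t o) (W t o))
        ≤ a₁ (W t o) + b₁ * ω (factor G W x₀ t o) := hA4.growth_G _ _
      _ ≤ a + b₁ * B := add_le_add (ha' _) (mul_le_mul_of_nonneg_left ih hA4.b₁_pos.le)
      _ ≤ B := by linarith

variable [IsProbabilityMeasure P] [CompactSpace U] [Nonempty U]

theorem IsBellmanSolution.unique (hA1 : IsIIDNoise P W)
    (hM : IsControlModel (P.map (W 0)) s G F ω b₁ b₂)
    (hmin : IsLocallyMinorized (P.map (W 0)) G ω) (hγ : γ < 0) {v' : Vec k → ℝ} {lam' : ℝ}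
    (h : IsBellmanSolution P G F W ω γ v lam) (h' : IsBellmanSolution P G F W ω γ v' lam') :
    lam' = lam ∧ ∃ c, ∀ x, v' x = v x + c := by
  have hW := hA1.measurable 0
  have : IsProbabilityMeasure (P.map (W 0)) := Measure.isProbabilityMeasure_map hW.aemeasurable
  obtain ⟨C, hv, hfix⟩ := (isBellmanSolution_iff hW hM hγ.ne).mp h
  obtain ⟨C', hv', hfix'⟩ := (isBellmanSolution_iff hW hM hγ.ne).mp h'
  exact hM.bellman_solution_unique hmin hγ hv hv' hfix hfix'

theorem IsBellmanSolution.optimalValue_le (hA1 : IsIIDNoise P W)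
    (hM : IsControlModel (P.map (W 0)) s G F ω b₁ b₂) (hγ : γ < 0)
    (h : IsBellmanSolution P G F W ω γ v lam) (x₀ : Vec k) (hV : 0 < V₀) :
    optimalValue P G F W γ x₀ V₀ ≤ (lam : EReal) := by
  have hW := hA1.measurable 0
  have : IsProbabilityMeasure (P.map (W 0)) := Measure.isProbabilityMeasure_map hW.aemeasurable
  obtain ⟨C, hv, hfix⟩ := (isBellmanSolution_iff hW hM hγ.ne).mp h
  exact iSup_le fun H => riskSensitiveCriterion_le hA1 hM H.2 hV hγ hv fun _ _ =>
    (hM.util_le_bellman hv γ _ _).trans_eq (hfix _).symm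

theorem IsBellmanSolution.riskSensitiveCriterion_feedback_eq (hA1 : IsIIDNoise P W)
    (hM : IsControlModel (P.map (W 0)) s G F ω b₁ b₂) (hγ : γ ≠ 0)
    (h : IsBellmanSolution P G F W ω γ v lam) {η : Vec k → U}
    (hη : IsBellmanSelector P G F W γ v η) {x₀ : Vec k} {B : ℝ}
    (hB : ∀ t o, ω (factor G W x₀ t o) ≤ B) (hV : 0 < V₀) :
    riskSensitiveCriterion P γ (portfolioValue G F W x₀ V₀ fun t o => η (factor G W x₀ t o)) =
      (lam : EReal) := by
  have hW := hA1.measurable 0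
  obtain ⟨C, hv, hfix⟩ := (isBellmanSolution_iff hW hM hγ).mp h
  have hmax := ((isBellmanSelector_iff hW hM hγ hv).mp hη).2
  exact riskSensitiveCriterion_eq hA1 hM (isAdmissible_feedback hM.measurable_map hη.1 x₀) hV hγ hv
    hB fun _ _ => (hmax _).trans (hfix _).symm

theorem IsBellmanSolution.optimalValue_eq (hA1 : IsIIDNoise P W)
    (hM : IsControlModel (P.map (W 0)) s G F ω b₁ b₂) (hγ : γ < 0)
    (h : IsBellmanSolution P G F W ω γ v lam) {η : Vec k → U}
    (hη : IsBellmanSelector P G F W γ v η) {x₀ : Vec k} {B : ℝ}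
    (hB : ∀ t o, ω (factor G W x₀ t o) ≤ B) (hV : 0 < V₀) :
    optimalValue P G F W γ x₀ V₀ = (lam : EReal) := by
  refine (h.optimalValue_le hA1 hM hγ x₀ hV).antisymm ?_
  rw [← h.riskSensitiveCriterion_feedback_eq hA1 hM hγ.ne hη hB hV]
  exact le_iSup (fun H : {H : ℕ → Ω → U // IsAdmissible W H} =>
    riskSensitiveCriterion P γ (portfolioValue G F W x₀ V₀ H.1))
    ⟨_, isAdmissible_feedback hM.measurable_map hη.1 x₀⟩

end OptimalStrategies

end RSC

theorem mainTheorem3_general {Ω : Type*} [MeasurableSpace Ω] (P : Measure Ω)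
    [IsProbabilityMeasure P] (k m n : ℕ) (U : Set (RSC.Vec m)) (hU : IsCompact U)
    (hU' : U.Nonempty) (W : ℕ → Ω → RSC.Vec n) (hA1 : RSC.IsIIDNoise P W)
    (G : RSC.Vec k → RSC.Vec n → RSC.Vec k) (hA2 : RSC.IsFactorMap G)
    (F : RSC.Vec k → U → RSC.Vec n → ℝ) (hA3 : RSC.IsLogReturnMap F)
    (ω : RSC.Vec k → ℝ) (a₁ a₂ : RSC.Vec n → ℝ) (b₁ b₂ : ℝ)
    (hA4 : RSC.HasWeightedGrowth P W G F ω a₁ a₂ b₁ b₂)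
    (hA5 : RSC.HasLocalMinorization P W G ω) :
    ∃ γ₀ : ℝ, γ₀ < 0 ∧ ∀ γ : ℝ, γ₀ < γ → γ < 0 →
      ∃ (v : RSC.Vec k → ℝ) (lam : ℝ),
        RSC.IsBellmanSolution P G F W ω γ v lam ∧
        (∀ (v' : RSC.Vec k → ℝ) (lam' : ℝ), RSC.IsBellmanSolution P G F W ω γ v' lam' →
          lam' = lam ∧ ∃ c : ℝ, ∀ x, v' x = v x + c) ∧
        (∀ (x₀ : RSC.Vec k) (V₀ : ℝ), 0 < V₀ →
          RSC.optimalValue P G F W γ x₀ V₀ ≤ (lam : EReal)) ∧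
        (BddAbove (Set.range a₁) →
          (∀ (x₀ : RSC.Vec k) (V₀ : ℝ), 0 < V₀ →
            RSC.optimalValue P G F W γ x₀ V₀ = (lam : EReal)) ∧
          (∃ η : RSC.Vec k → U, RSC.IsBellmanSelector P G F W γ v η) ∧
          ∀ η : RSC.Vec k → U, RSC.IsBellmanSelector P G F W γ v η →
            ∀ (x₀ : RSC.Vec k) (V₀ : ℝ), 0 < V₀ →
              RSC.IsAdmissible W (fun t o => η (RSC.factor G W x₀ t o)) ∧
              RSC.riskSensitiveCriterion P γ (RSC.portfolioValue G F W x₀ V₀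
                (fun t o => η (RSC.factor G W x₀ t o))) = (lam : EReal)) := by
  have : CompactSpace U := isCompact_iff_compactSpace.mp hU
  have : Nonempty U := hU'.to_subtype
  have hW := hA1.measurable 0
  have : IsProbabilityMeasure (P.map (W 0)) := Measure.isProbabilityMeasure_map hW.aemeasurable
  have hM := hA4.isControlModel hW hA2 hA3
  have hmin := hA5.isLocallyMinorized hW hA2
  obtain ⟨γ₀, hγ₀, hsol⟩ := hM.exists_bellman_solution hmin
  refine ⟨γ₀, hγ₀, fun γ hγ₀γ hγ => ?_⟩
  obtain ⟨C, v, lam, hv, hfix⟩ := hsol γ hγ₀γ hγ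
  have hbell : RSC.IsBellmanSolution P G F W ω γ v lam :=
    (RSC.isBellmanSolution_iff hW hM hγ.ne).mpr ⟨C, hv, hfix⟩
  obtain ⟨η, hη⟩ := RSC.exists_isBellmanSelector hW hM hγ.ne hv
  refine ⟨v, lam, hbell, fun _ _ h' => hbell.unique hA1 hM hmin hγ h',
    fun x₀ _ hV => hbell.optimalValue_le hA1 hM hγ x₀ hV, fun ha => ?_⟩
  refine ⟨fun x₀ V₀ hV => ?_, ⟨η, hη⟩, fun ζ hζ x₀ V₀ hV =>
    ⟨RSC.isAdmissible_feedback hM.measurable_map hζ.1 x₀, ?_⟩⟩ <;>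
  obtain ⟨B, hB⟩ := hA4.exists_weight_factor_le ha x₀
  · exact hbell.optimalValue_eq hA1 hM hγ hη hB hV
  · exact hbell.riskSensitiveCriterion_feedback_eq hA1 hM hγ.ne hζ hB hV

theorem mainTheorem3 {Ω : Type*} [MeasurableSpace Ω] (P : Measure Ω) [IsProbabilityMeasure P]
    (k m : ℕ) (U : Set (RSC.Vec m)) (hU : IsCompact U) (hU' : U.Nonempty)
    (W : ℕ → Ω → RSC.Vec (k + m)) (hA1 : RSC.IsIIDNoise P W)
    (G : RSC.Vec k → RSC.Vec (k + m) → RSC.Vec k) (hA2 : RSC.IsFactorMap G)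
    (F : RSC.Vec k → U → RSC.Vec (k + m) → ℝ) (hA3 : RSC.IsLogReturnMap F)
    (ω : RSC.Vec k → ℝ) (a₁ a₂ : RSC.Vec (k + m) → ℝ) (b₁ b₂ : ℝ)
    (hA4 : RSC.HasWeightedGrowth P W G F ω a₁ a₂ b₁ b₂)
    (hA5 : RSC.HasLocalMinorization P W G ω) :
    ∃ γ₀ : ℝ, γ₀ < 0 ∧ ∀ γ : ℝ, γ₀ < γ → γ < 0 →
      ∃ (v : RSC.Vec k → ℝ) (lam : ℝ),
        RSC.IsBellmanSolution P G F W ω γ v lam ∧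
        (∀ (v' : RSC.Vec k → ℝ) (lam' : ℝ), RSC.IsBellmanSolution P G F W ω γ v' lam' →
          lam' = lam ∧ ∃ c : ℝ, ∀ x, v' x = v x + c) ∧
        (∀ (x₀ : RSC.Vec k) (V₀ : ℝ), 0 < V₀ →
          RSC.optimalValue P G F W γ x₀ V₀ ≤ (lam : EReal)) ∧
        (BddAbove (Set.range a₁) →
          (∀ (x₀ : RSC.Vec k) (V₀ : ℝ), 0 < V₀ →
            RSC.optimalValue P G F W γ x₀ V₀ = (lam : EReal)) ∧
          (∃ η : RSC.Vec k → U, RSC.IsBellmanSelector P G F W γ v η) ∧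
          ∀ η : RSC.Vec k → U, RSC.IsBellmanSelector P G F W γ v η →
            ∀ (x₀ : RSC.Vec k) (V₀ : ℝ), 0 < V₀ →
              RSC.IsAdmissible W (fun t o => η (RSC.factor G W x₀ t o)) ∧
              RSC.riskSensitiveCriterion P γ (RSC.portfolioValue G F W x₀ V₀
                (fun t o => η (RSC.factor G W x₀ t o))) = (lam : EReal)) :=
  mainTheorem3_general P k m (k + m) U hU hU' W hA1 G hA2 F hA3 ω a₁ a₂ b₁ b₂ hA4 hA5
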